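/- Let $d\ge 1$, $\mathbb R_+=[0,\infty)$, and let $|\cdot|$ be the Euclidean norm on $\mathbb R^d$. Assume: (H1) $\Omega\subset\mathbb R^d$ is nonempty, open and bounded. (H2) $\Xi\subset\overline\Omega$ is nonempty and closed. (H3) $\ell:\mathbb R_+\times\overline\Omega\times\mathbb R^d\to\mathbb R_+$ is such that $t\mapsto\ell(t,x,p)$ is (Lebesgue) measurable for every $(x,p)$; for almost every $t$ the map $(x,p)\mapsto\ell(t,x,p)$ is continuous and, for every $x$, the map $p\mapsto\ell(t,x,p)$ is convex; and there are $\alpha>0$, $\theta>1$ with $\ell(t,x,p)\ge\alpha|p|^\theta$ for all $(t,x,p)$. (H4) $h:\mathbb R_+\times\overline\Omega\times\overline\Omega\times\mathbb R^d\times\mathbb R^d\to\mathbb R_+$ is such that $t\mapsto h(t,x,\tilde x,p,\tilde p)$ is (Lebesgue) measurable for every $(x,\tilde x,p,\tilde p)$; for almost every $t$ the map $(x,\tilde x,p,\tilde p)\mapsto h(t,x,\tilde x,p,\tilde p)$ is continuous and, for every $(x,\tilde x)$, the map $(p,\tilde p)\mapsto h(t,x,\tilde x,p,\tilde p)$ is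 convex; $h(t,x,\tilde x,p,\tilde p)=h(t,\tilde x,x,\tilde p,p)$ for all arguments; and there are $C>0$ and $\beta\in(0,\theta]$ with $h(t,x,\tilde x,p,\tilde p)\le C(|p|^\beta+|\tilde p|^\beta)$ for all arguments. (H5) $\Psi:\mathbb R_+\to\mathbb R_+$ is lower semicontinuous and nondecreasing, and there are $a,b>0$ with $\Psi(t)\ge at-b$ for all $t\in\mathbb R_+$. Set $\Psi(+\infty)=+\infty$. Let $\Gamma=\mathcal C(\mathbb R_+;\overline\Omega)$ with the topology of uniform convergence on compact time intervals and its Borel $\sigma$-algebra. For $\gamma\in\Gamma$ put $\tau(\gamma)=\inf\{t\in\mathbb R_+:\gamma(t)\in\Xi\}$, with $\inf\emptyset=+\infty$. A curve in $\Gamma$ is called absolutely continuous if it is so on every compact interval $[0,T]$; its derivative $\dot\gamma$ then exists almost everywhere. (H6) There is $\kappa>0$ such that for every $x_0\in\overline\Omega$ there is an absolutely continuous $\gamma\in\Gamma$ with $\gamma(0)=x_0$ and $\int_0^{\infty}\ell(t,\gamma(t),\dot\gamma(t))\,dt+\Psi(\tau(\gamma))\le\kappa$. For $\gamma\in\Gamma$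 and a Borel probability measure $Q\in\mathcal P(\Gamma)$ define $$F(\gamma,Q)=\int_0^{\infty}\ell(t,\gamma(t),\dot\gamma(t))\,dt+\Psi(\tau(\gamma))+\int_\Gamma\int_0^{\tau(\gamma)\wedge\tau(\tilde\gamma)}h(t,\gamma(t),\tilde\gamma(t),\dot\gamma(t),\dot{\tilde\gamma}(t))\,dt\,dQ(\tilde\gamma)\in[0,+\infty],$$ with the convention that $F(\gamma,Q)=+\infty$ if $\gamma$ is not absolutely continuous, if it is not the case that $Q$-almost every curve is absolutely continuous, or if the inner integral is not a $Q$-integrable function of $\tilde\gamma$. Then for every Borel probability measure $m_0\in\mathcal P(\overline\Omega)$ there exists an equilibrium with initial condition $m_0$, that is, a measure $Q\in\mathcal P(\Gamma)$ such that the image of $Q$ under $\gamma\mapsto\gamma(0)$ is $m_0$, the function $\gamma\mapsto F(\gamma,Q)$ is $Q$-measurable with $\int_\Gamma F(\gamma,Q)\,dQ(\gamma)<+\infty$, and, for $Q$-almost every $\gamma$, $$F(\gamma,Q)=\inf_{\omega\in\Gamma,\ \omega(0)=\gamma(0)}F(\omega,Q).$$ -/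

import Mathlib

open MeasureTheory
open scoped NNReal ENNReal

noncomputable section

namespace MFG

/-- Lebesgue measure on the half-line of nonnegative real numbers. -/
def lebesgueHalfLine : Measure ℝ≥0 :=
  (volume : Measure ℝ).comap ((↑) : ℝ≥0 → ℝ)

/-- The space `Γ` of continuous curves from the half-line to the closure of `Ω`. Its topology is
the compact-open one, i.e. that of uniform convergence on compact time intervals. -/
abbrev Curve {d : ℕ} (Ω : Set (EuclideanSpace ℝ (Fin d))) : Type :=
  C(ℝ≥0, closure Ω)

/-- The space of curves carries its Borel σ-algebra. -/
instance instMeasurableSpaceCurve {d : ℕ} (Ω : Set (EuclideanSpace ℝ (Fin d))) :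
    MeasurableSpace (Curve Ω) :=
  borel (Curve Ω)

instance instBorelSpaceCurve {d : ℕ} (Ω : Set (EuclideanSpace ℝ (Fin d))) :
    BorelSpace (Curve Ω) :=
  ⟨rfl⟩

/-- A curve viewed as a function of a real variable (constant on the negative half-line). -/
def realPath {d : ℕ} {Ω : Set (EuclideanSpace ℝ (Fin d))} (γ : Curve Ω) :
    ℝ → EuclideanSpace ℝ (Fin d) :=
  fun s => (γ s.toNNReal : EuclideanSpace ℝ (Fin d))

/-- The curve is absolutely continuous on every compact time interval. -/
def IsAbsCont {d : ℕ} {Ω : Set (EuclideanSpace ℝ (Fin d))} (γ : Curve Ω) : Prop :=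
  ∀ T : ℝ, 0 < T → AbsolutelyContinuousOnInterval (realPath γ) 0 T

/-- The velocity of the curve at time `t`; for an absolutely continuous curve it is the derivative
at almost every time. -/
def velocity {d : ℕ} {Ω : Set (EuclideanSpace ℝ (Fin d))} (γ : Curve Ω) (t : ℝ≥0) :
    EuclideanSpace ℝ (Fin d) :=
  deriv (realPath γ) (t : ℝ)

/-- The first time at which the curve meets `Ξ`, equal to `⊤` if it never does. -/
def exitTime {d : ℕ} {Ω : Set (EuclideanSpace ℝ (Fin d))}
    (Ξ : Set (EuclideanSpace ℝ (Fin d))) (γ : Curve Ω) : ℝ≥0∞ :=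
  sInf {s : ℝ≥0∞ | ∃ t : ℝ≥0, (γ t : EuclideanSpace ℝ (Fin d)) ∈ Ξ ∧ s = (t : ℝ≥0∞)}

/-- The extension of `Ψ` to `[0, ∞]` by the value `∞` at `∞`. -/
def extendTop (Ψ : ℝ≥0 → ℝ≥0) (s : ℝ≥0∞) : ℝ≥0∞ :=
  if s = ⊤ then ⊤ else (Ψ s.toNNReal : ℝ≥0∞)

/-- The individual cost: the running cost over the whole half-line plus the exit-time cost. -/
def individualCost {d : ℕ} {Ω : Set (EuclideanSpace ℝ (Fin d))}
    (Ξ : Set (EuclideanSpace ℝ (Fin d)))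
    (ℓ : ℝ≥0 → closure Ω → EuclideanSpace ℝ (Fin d) → ℝ≥0)
    (Ψ : ℝ≥0 → ℝ≥0) (γ : Curve Ω) : ℝ≥0∞ :=
  (∫⁻ t, (ℓ t (γ t) (velocity γ t) : ℝ≥0∞) ∂lebesgueHalfLine) + extendTop Ψ (exitTime Ξ γ)

/-- The interaction cost of two curves, accumulated until one of them reaches `Ξ`. -/
def pairCost {d : ℕ} {Ω : Set (EuclideanSpace ℝ (Fin d))}
    (Ξ : Set (EuclideanSpace ℝ (Fin d)))
    (h : ℝ≥0 → closure Ω → closure Ω → EuclideanSpace ℝ (Fin d) →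
      EuclideanSpace ℝ (Fin d) → ℝ≥0)
    (γ γ' : Curve Ω) : ℝ≥0∞ :=
  ∫⁻ t in {t : ℝ≥0 | (t : ℝ≥0∞) < min (exitTime Ξ γ) (exitTime Ξ γ')},
    (h t (γ t) (γ' t) (velocity γ t) (velocity γ' t) : ℝ≥0∞) ∂lebesgueHalfLine

open Classical in
/-- The cost `F(γ, Q)` of an agent following `γ` when the trajectories of all agents are
distributed according to `Q`. By convention it is `∞` if `γ` is not absolutely continuous, if `Q`
is not carried by the absolutely continuous curves, or if the interaction cost with `γ` is not
`Q`-integrable. -/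
def cost {d : ℕ} {Ω : Set (EuclideanSpace ℝ (Fin d))}
    (Ξ : Set (EuclideanSpace ℝ (Fin d)))
    (ℓ : ℝ≥0 → closure Ω → EuclideanSpace ℝ (Fin d) → ℝ≥0)
    (h : ℝ≥0 → closure Ω → closure Ω → EuclideanSpace ℝ (Fin d) →
      EuclideanSpace ℝ (Fin d) → ℝ≥0)
    (Ψ : ℝ≥0 → ℝ≥0) (γ : Curve Ω) (Q : ProbabilityMeasure (Curve Ω)) : ℝ≥0∞ :=
  if IsAbsCont γ ∧ (∀ᵐ γ' ∂(Q : Measure (Curve Ω)), IsAbsCont γ') ∧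
      AEMeasurable (fun γ' => pairCost Ξ h γ γ') (Q : Measure (Curve Ω)) ∧
      ∫⁻ γ', pairCost Ξ h γ γ' ∂(Q : Measure (Curve Ω)) < ⊤ then
    individualCost Ξ ℓ Ψ γ + ∫⁻ γ', pairCost Ξ h γ γ' ∂(Q : Measure (Curve Ω))
  else ⊤

/-- `Q` is an equilibrium with initial condition `m₀`: the law of `γ(0)` under `Q` is `m₀`, the
function `F(·, Q)` is measurable with finite `Q`-integral, and `Q`-almost every curve minimizes
`F(·, Q)` among all curves with the same starting point. -/
structure IsEquilibrium {d : ℕ} {Ω : Set (EuclideanSpace ℝ (Fin d))}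
    (Ξ : Set (EuclideanSpace ℝ (Fin d)))
    (ℓ : ℝ≥0 → closure Ω → EuclideanSpace ℝ (Fin d) → ℝ≥0)
    (h : ℝ≥0 → closure Ω → closure Ω → EuclideanSpace ℝ (Fin d) →
      EuclideanSpace ℝ (Fin d) → ℝ≥0)
    (Ψ : ℝ≥0 → ℝ≥0) (m₀ : ProbabilityMeasure (closure Ω))
    (Q : ProbabilityMeasure (Curve Ω)) : Prop where
  initial : (Q : Measure (Curve Ω)).map (fun γ : Curve Ω => γ 0) = (m₀ : Measure (closure Ω))
  cost_aemeasurable :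
    AEMeasurable (fun γ => cost Ξ ℓ h Ψ γ Q) (Q : Measure (Curve Ω))
  cost_lt_top : ∫⁻ γ, cost Ξ ℓ h Ψ γ Q ∂(Q : Measure (Curve Ω)) < ⊤
  optimal : ∀ᵐ γ ∂(Q : Measure (Curve Ω)),
    cost Ξ ℓ h Ψ γ Q = ⨅ ω : {ω : Curve Ω // ω 0 = γ 0}, cost Ξ ℓ h Ψ ω Q

end MFG

end

/-!
The game is a potential game. Let `L γ` be the individual cost of a curve, set to `∞` if `γ` is not
absolutely continuous, let `H γ γ'` be the interaction cost, and let
`G (γ, γ') = L γ + L γ' + H γ γ'` be the total cost of a pair of agents. An equilibrium is found by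
minimizing the energy `∬ G dQ dQ` over the laws `Q` of curves with initial distribution `m₀`. Since
`G` is symmetric, the derivative of the energy at `Q` in the direction of `Q'` is governed by the
marginal `γ ↦ ∫ G (γ, γ') dQ(γ')`, and this marginal is `F(γ, Q)` up to the additive constant
`∫ L dQ` (`MFG.cost_add_lintegral_acCost`).

*Existence of a minimizer* (`MFG.PairGame.exists_minimizer`). Superlinearity of the running cost
bounds the integral of `‖γ̇‖ ^ θ`, hence gives a Hölder modulus of continuity, so that by
Arzelà–Ascoli the sublevel sets of `L` are compact (`MFG.isCompact_acCost_sublevel`) and by Markov's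
inequality and Prokhorov's theorem so is the set of laws of bounded energy. The energy is lower
semicontinuous because `G` is (`MFG.lowerSemicontinuous_totalPairCost`); this rests on Tonelli's
lower semicontinuity theorem `MFG.lintegral_le_liminf_of_convex`, proved by writing a convex
Carathéodory integrand as a countable supremum of localized affine functions of the velocity. The
growth condition on `h` together with the linear growth of `Ψ` bounds `H` by the individual costs
(`MFG.exists_pairCost_le`), so that laws of finite mean individual cost have finite energy.

*Optimality of almost every curve* (`MFG.PairGame.ae_optimal`). If, for some rational `r`, the
curves of marginal cost above `r` whose starting point admits a curve of marginal cost at most `r`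
had positive mass, that mass could be moved to the compact set of curves of marginal cost at most
`r` while keeping the initial positions, which would contradict the first-order condition
`MFG.PairGame.first_variation`. Moving the mass requires lifting a measure on the starting points
to a measure on a compact set of curves (`MFG.exists_measure_map_eq_of_isCompact`); this is
done by weak compactness and replaces a measurable selection of optimal curves. The same lifting
provides a competitor of finite energy.
-/

namespace MFG

open Filter Set TopologicalSpace
open scoped Topology

/-! ### Lower semicontinuity of integrals with respect to the measure -/

lemma add_liminf_le (u v : ℕ → ℝ≥0∞) :
    liminf u atTop + liminf v atTop ≤ liminf (fun n => u n + v n) atTop := by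
  simp only [liminf_eq_iSup_iInf_of_nat]
  rw [ENNReal.iSup_add_iSup_of_monotone]
  · refine iSup_mono fun n => le_iInf₂ fun i hi => ?_
    exact add_le_add (iInf₂_le i hi) (iInf₂_le i hi)
  · exact fun m n hmn => le_iInf₂ fun i hi => iInf₂_le i (hmn.trans hi)
  · exact fun m n hmn => le_iInf₂ fun i hi => iInf₂_le i (hmn.trans hi)

lemma lowerSemicontinuous_of_seq {X β : Type*} [TopologicalSpace X] [SequentialSpace X]
    [LinearOrder β] {f : X → β}
    (h : ∀ (u : ℕ → X) (x : X) (c : β), Tendsto u atTop (𝓝 x) → (∀ n, f (u n) ≤ c) → f x ≤ c) :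
    LowerSemicontinuous f := by
  rw [lowerSemicontinuous_iff_isClosed_preimage]
  intro c
  apply IsSeqClosed.isClosed
  intro u x hu hx
  exact h u x c hx hu

/-- Lower semicontinuous functions on a separable metrizable space pass to the limit in the sense
of the portmanteau theorem. -/
lemma lintegral_le_liminf_of_tendsto {X : Type*} [TopologicalSpace X] [MetrizableSpace X]
    [SecondCountableTopology X] [MeasurableSpace X] [BorelSpace X]
    {f : X → ℝ≥0∞} (hf : LowerSemicontinuous f) {Q : ProbabilityMeasure X}
    {u : ℕ → ProbabilityMeasure X} (hu : Tendsto u atTop (𝓝 Q)) :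
    ∫⁻ x, f x ∂(Q : Measure X) ≤ liminf (fun n => ∫⁻ x, f x ∂(u n : Measure X)) atTop := by
  -- the layer-cake formula for the truncations reduces the claim to the open sets `{f > t}`
  have htrunc : ∀ N : ℕ, ∫⁻ x, min (f x) N ∂(Q : Measure X) ≤
      liminf (fun n => ∫⁻ x, f x ∂(u n : Measure X)) atTop := by
    intro N
    have hne : ∀ x, min (f x) (N : ℝ≥0∞) ≠ ⊤ := fun x =>
      ne_top_of_le_ne_top (ENNReal.natCast_ne_top N) (min_le_right _ _)
    have hmeas : Measurable fun x => (min (f x) (N : ℝ≥0∞)).toReal :=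
      (hf.measurable.min measurable_const).ennreal_toReal
    have hrew : ∀ μ : Measure X, ∫⁻ x, min (f x) N ∂μ =
        ∫⁻ t in Ioi (0 : ℝ), μ {x | t < (min (f x) (N : ℝ≥0∞)).toReal} := by
      intro μ
      rw [← lintegral_eq_lintegral_meas_lt μ (Eventually.of_forall fun x => ENNReal.toReal_nonneg)
        hmeas.aemeasurable]
      exact lintegral_congr fun x => (ENNReal.ofReal_toReal (hne x)).symm
    calc ∫⁻ x, min (f x) N ∂(Q : Measure X)
        = ∫⁻ t in Ioi (0 : ℝ), (Q : Measure X) {x | t < (min (f x) (N : ℝ≥0∞)).toReal} := hrew _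
      _ ≤ ∫⁻ t in Ioi (0 : ℝ), liminf
          (fun n => (u n : Measure X) {x | t < (min (f x) (N : ℝ≥0∞)).toReal}) atTop := by
        refine setLIntegral_mono' measurableSet_Ioi fun t ht => ?_
        refine ProbabilityMeasure.le_liminf_measure_open_of_tendsto hu ?_
        have : {x | t < (min (f x) (N : ℝ≥0∞)).toReal} =
            f ⁻¹' Ioi (ENNReal.ofReal t) ∩ {_x | ENNReal.ofReal t < N} := by
          ext x
          simp only [mem_ofPred_eq, mem_inter_iff, mem_preimage, mem_Ioi]
          rw [← ENNReal.ofReal_lt_iff_lt_toReal (le_of_lt ht) (hne x), lt_min_iff]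
        rw [this]
        exact (hf.isOpen_preimage _).inter isOpen_const
      _ ≤ liminf (fun n => ∫⁻ t in Ioi (0 : ℝ),
          (u n : Measure X) {x | t < (min (f x) (N : ℝ≥0∞)).toReal}) atTop :=
        lintegral_liminf_le fun n => Antitone.measurable fun s t hst =>
          measure_mono fun x hx => lt_of_le_of_lt hst hx
      _ ≤ liminf (fun n => ∫⁻ x, f x ∂(u n : Measure X)) atTop := by
        refine liminf_le_liminf (Eventually.of_forall fun n => ?_)
        show _ ≤ ∫⁻ x, f x ∂(u n : Measure X)
        rw [← hrew]
        exact lintegral_mono fun x => min_le_left _ _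
  have hsup : ∀ x, f x = ⨆ N : ℕ, min (f x) (N : ℝ≥0∞) := by
    intro x
    rw [← inf_iSup_eq, ENNReal.iSup_natCast, inf_top_eq]
  calc ∫⁻ x, f x ∂(Q : Measure X) = ∫⁻ x, ⨆ N : ℕ, min (f x) (N : ℝ≥0∞) ∂(Q : Measure X) :=
        lintegral_congr hsup
    _ = ⨆ N : ℕ, ∫⁻ x, min (f x) (N : ℝ≥0∞) ∂(Q : Measure X) :=
        lintegral_iSup (fun N => hf.measurable.min measurable_const) fun M N hMN x =>
          min_le_min_left _ (by exact_mod_cast hMN)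
    _ ≤ _ := iSup_le htrunc

lemma lowerSemicontinuous_lintegral {X : Type*} [TopologicalSpace X] [MetrizableSpace X]
    [SecondCountableTopology X] [MeasurableSpace X] [BorelSpace X]
    {f : X → ℝ≥0∞} (hf : LowerSemicontinuous f) :
    LowerSemicontinuous fun Q : ProbabilityMeasure X => ∫⁻ x, f x ∂(Q : Measure X) := by
  refine lowerSemicontinuous_of_seq fun u Q c hu hc => ?_
  refine (lintegral_le_liminf_of_tendsto hf hu).trans ?_
  refine (liminf_le_liminf (Eventually.of_forall hc)).trans ?_
  simp

/-! ### Lifting measures to compact sets -/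

/-- A finite measure carried by the image of a compact set `K` under a continuous map is the image
of a measure carried by `K`. -/
lemma exists_measure_map_eq_of_isCompact {Γ X : Type*} [TopologicalSpace Γ] [T2Space Γ]
    [MeasurableSpace Γ] [BorelSpace Γ] [TopologicalSpace X] [MetrizableSpace X]
    [SecondCountableTopology X] [MeasurableSpace X] [BorelSpace X]
    {e : Γ → X} (he : Continuous e) {K : Set Γ} (hK : IsCompact K)
    (μ : Measure X) [IsFiniteMeasure μ] (hμ : μ (e '' K)ᶜ = 0) :
    ∃ ν : Measure Γ, IsFiniteMeasure ν ∧ ν Kᶜ = 0 ∧ ν.map e = μ := by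
  rcases K.eq_empty_or_nonempty with rfl | ⟨γ₀, hγ₀⟩
  · refine ⟨0, inferInstance, by simp, ?_⟩
    simp only [image_empty, compl_empty, Measure.measure_univ_eq_zero] at hμ
    simp [hμ]
  let _ := metrizableSpaceMetric X
  have : CompactSpace K := isCompact_iff_compactSpace.mp hK
  let eK : K → X := fun γ => e γ
  have heK : Continuous eK := he.comp continuous_subtype_val
  have hcl : IsClosed (e '' K) := (hK.image he).isClosed
  -- a section of `e` over `e '' K`, composed only with simple functions
  have hsec : ∀ x : X, ∃ γ : K, x ∈ e '' K → eK γ = x := by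
    intro x
    by_cases hx : x ∈ e '' K
    · obtain ⟨γ, hγ, rfl⟩ := hx
      exact ⟨⟨γ, hγ⟩, fun _ => rfl⟩
    · exact ⟨⟨γ₀, hγ₀⟩, fun h => absurd h hx⟩
  choose σ hσ using hsec
  have h0 : e γ₀ ∈ e '' K := mem_image_of_mem _ hγ₀
  let a : ℕ → SimpleFunc X X := SimpleFunc.approxOn id measurable_id (e '' K) (e γ₀) h0
  have ha : ∀ n x, a n x ∈ e '' K := fun n x => SimpleFunc.approxOn_mem _ _ _ _
  let ν : ℕ → FiniteMeasure K := fun n => ⟨μ.map ((a n).map σ), inferInstance⟩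
  have hνmass : ∀ n, (ν n).mass = (μ univ).toNNReal := by
    intro n
    show ((μ.map ((a n).map σ)) univ).toNNReal = _
    rw [Measure.map_apply ((a n).map σ).measurable MeasurableSet.univ, preimage_univ]
  have hmap : ∀ n, ((ν n).map eK : Measure X) = μ.map (a n) := by
    intro n
    rw [FiniteMeasure.toMeasure_map]
    show (μ.map ((a n).map σ)).map eK = _
    rw [Measure.map_map heK.measurable ((a n).map σ).measurable]
    congr 1
    ext x
    simp only [Function.comp_apply, SimpleFunc.map_apply]
    exact hσ _ (ha n x)
  let M : FiniteMeasure X := ⟨μ, inferInstance⟩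
  have hlim : Tendsto (fun n => (ν n).map eK) atTop (𝓝 M) := by
    rw [FiniteMeasure.tendsto_iff_forall_lintegral_tendsto]
    intro f
    have h1 : ∀ n, ∫⁻ x, f x ∂((ν n).map eK : Measure X) = ∫⁻ x, f (a n x) ∂μ := by
      intro n
      rw [hmap, lintegral_map (by fun_prop) (a n).measurable]
    simp only [h1]
    show Tendsto _ _ (𝓝 (∫⁻ x, f x ∂μ))
    refine tendsto_lintegral_of_dominated_convergence (fun _ => ((nndist f 0 : ℝ≥0) : ℝ≥0∞))
      ?_ ?_ ?_ ?_
    · intro n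
      exact (f.continuous.measurable.comp (a n).measurable).coe_nnreal_ennreal
    · intro n
      refine Eventually.of_forall fun x => ?_
      exact ENNReal.coe_le_coe.2 (BoundedContinuousFunction.NNReal.upper_bound f (a n x))
    · simp only [lintegral_const]
      exact ENNReal.mul_ne_top ENNReal.coe_ne_top (measure_ne_top _ _)
    · have hae : ∀ᵐ x ∂μ, x ∈ e '' K := by
        rw [ae_iff]; exact hμ
      filter_upwards [hae] with x hx
      have := SimpleFunc.tendsto_approxOn measurable_id h0 (x := x) (subset_closure hx)
      have hc : Tendsto (fun n => f (a n x)) atTop (𝓝 (f x)) :=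
        (f.continuous.tendsto x).comp this
      exact (ENNReal.continuous_coe.tendsto _).comp hc
  have hcomp : IsCompact ((fun ν : FiniteMeasure K => ν.map eK) ''
      {ν | ν.mass = (μ univ).toNNReal}) :=
    (isCompact_setOfPred_finiteMeasure_eq_of_compactSpace K _).image
      (FiniteMeasure.continuous_map heK)
  -- the images of the compact set of measures on `K` of the right mass form a closed set
  have hmem : M ∈ ((fun ν : FiniteMeasure K => ν.map eK) '' {ν | ν.mass = (μ univ).toNNReal}) :=
    hcomp.isClosed.mem_of_tendsto hlim (Eventually.of_forall fun n => ⟨ν n, hνmass n, rfl⟩)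
  obtain ⟨N, -, hN⟩ := hmem
  have hval : Measurable (Subtype.val : K → Γ) := measurable_subtype_coe
  refine ⟨(N : Measure K).map Subtype.val, inferInstance, ?_, ?_⟩
  · rw [Measure.map_apply hval hK.measurableSet.compl]
    simp
  · rw [Measure.map_map he.measurable hval]
    have := congrArg (fun ν : FiniteMeasure X => (ν : Measure X)) hN
    rw [FiniteMeasure.toMeasure_map] at this
    exact this

/-! ### Symmetric pairwise-interaction games -/

/-- Abstract data of a symmetric pairwise-interaction game on a space `Γ` of strategies: an
individual cost `L` with compact sublevel sets, and a lower semicontinuous symmetric total cost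
`G γ γ'` of a pair of agents, comparable with `L γ + L γ'`. -/
structure PairGame {Γ X : Type*} [TopologicalSpace Γ] [TopologicalSpace X]
    (e : Γ → X) (L : Γ → ℝ≥0∞) (G : Γ × Γ → ℝ≥0∞) (K₁ K₂ κ : ℝ≥0) : Prop where
  continuous_start : Continuous e
  isCompact_sublevel : ∀ R : ℝ≥0, IsCompact {γ | L γ ≤ R}
  lsc_pair : LowerSemicontinuous G
  symm : ∀ γ γ', G (γ, γ') = G (γ', γ)
  le_pair : ∀ γ γ', L γ ≤ G (γ, γ')
  pair_le : ∀ γ γ', G (γ, γ') ≤ K₁ + K₂ * (L γ + L γ')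
  access : ∀ x, ∃ γ, e γ = x ∧ L γ ≤ κ

/-- The total cost of a pair of agents drawn independently from `μ` and `ν`. -/
noncomputable def pairEnergy {Γ : Type*} [MeasurableSpace Γ] (G : Γ × Γ → ℝ≥0∞)
    (μ ν : Measure Γ) : ℝ≥0∞ :=
  ∫⁻ γ, ∫⁻ γ', G (γ, γ') ∂ν ∂μ

section

variable {Γ X : Type*} [TopologicalSpace Γ] [MetrizableSpace Γ]
  [SecondCountableTopology Γ] [MeasurableSpace Γ] [BorelSpace Γ]
  [TopologicalSpace X] [MetrizableSpace X] [SecondCountableTopology X] [MeasurableSpace X]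
  [BorelSpace X]
  {e : Γ → X} {L : Γ → ℝ≥0∞} {G : Γ × Γ → ℝ≥0∞} {K₁ K₂ κ : ℝ≥0}

omit [MetrizableSpace Γ] in
lemma pairEnergy_comm (hG : LowerSemicontinuous G) (hs : ∀ γ γ', G (γ, γ') = G (γ', γ))
    (μ ν : Measure Γ) [SFinite μ] [SFinite ν] : pairEnergy G μ ν = pairEnergy G ν μ := by
  unfold pairEnergy
  rw [lintegral_lintegral_swap (f := fun γ γ' => G (γ, γ')) hG.measurable.aemeasurable]
  exact lintegral_congr fun γ => lintegral_congr fun γ' => hs _ _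

omit [MetrizableSpace Γ] in
/-- The energy is a quadratic form. -/
lemma pairEnergy_combo (hG : LowerSemicontinuous G) (hs : ∀ γ γ', G (γ, γ') = G (γ', γ))
    (μ ν : Measure Γ) [SFinite μ] [SFinite ν] (a b : ℝ≥0) :
    pairEnergy G (a • μ + b • ν) (a • μ + b • ν) =
      a * a * pairEnergy G μ μ + 2 * (a * b) * pairEnergy G μ ν + b * b * pairEnergy G ν ν := by
  have hcomm := pairEnergy_comm hG hs ν μ
  have hmeas : ∀ ρ : Measure Γ, SFinite ρ → Measurable fun γ => ∫⁻ γ', G (γ, γ') ∂ρ :=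
    fun ρ _ => hG.measurable.lintegral_prod_right'
  have h1 := hmeas μ inferInstance
  have h2 := hmeas ν inferInstance
  unfold pairEnergy at *
  simp only [lintegral_add_measure, lintegral_smul_measure, ENNReal.smul_def, smul_eq_mul]
  rw [lintegral_add_left (h1.const_mul _), lintegral_add_left (h1.const_mul _),
    lintegral_const_mul _ h1, lintegral_const_mul _ h2, lintegral_const_mul _ h1,
    lintegral_const_mul _ h2, hcomm]
  ring

namespace PairGame

variable (g : PairGame e L G K₁ K₂ κ)
include g

omit [SecondCountableTopology Γ] [MeasurableSpace Γ] [BorelSpace Γ] [MetrizableSpace X]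
  [SecondCountableTopology X] [MeasurableSpace X] [BorelSpace X] in
lemma lsc_cost : LowerSemicontinuous L := by
  rw [lowerSemicontinuous_iff_isClosed_preimage]
  intro c
  by_cases hc : c = ⊤
  · simp [hc]
  · have := (g.isCompact_sublevel c.toNNReal).isClosed
    rwa [ENNReal.coe_toNNReal hc] at this

omit [MetrizableSpace X] [SecondCountableTopology X] [MeasurableSpace X] [BorelSpace X] in
/-- The marginal cost of a strategy is lower semicontinuous, by Fatou's lemma. -/
lemma lsc_marginal (Q : ProbabilityMeasure Γ) :
    LowerSemicontinuous fun γ => ∫⁻ γ', G (γ, γ') ∂(Q : Measure Γ) := by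
  refine lowerSemicontinuous_of_seq fun u γ c hu hc => ?_
  calc ∫⁻ γ', G (γ, γ') ∂(Q : Measure Γ)
      ≤ ∫⁻ γ', liminf (fun n => G (u n, γ')) atTop ∂(Q : Measure Γ) := by
        refine lintegral_mono fun γ' => ?_
        have ht : Tendsto (fun n => (u n, γ')) atTop (𝓝 (γ, γ')) :=
          hu.prodMk_nhds tendsto_const_nhds
        exact (lowerSemicontinuous_iff_le_liminf.1 g.lsc_pair (γ, γ')).trans
          (liminf_le_liminf_of_le ht)
    _ ≤ liminf (fun n => ∫⁻ γ', G (u n, γ') ∂(Q : Measure Γ)) atTop :=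
        lintegral_liminf_le fun n => g.lsc_pair.measurable.comp measurable_prodMk_left
    _ ≤ c := by
        refine (liminf_le_liminf (Eventually.of_forall hc)).trans ?_
        simp

omit [MetrizableSpace Γ] [SecondCountableTopology Γ] [BorelSpace Γ] [MetrizableSpace X]
  [SecondCountableTopology X] [MeasurableSpace X] [BorelSpace X] in
lemma cost_le_marginal (Q : ProbabilityMeasure Γ) (γ : Γ) :
    L γ ≤ ∫⁻ γ', G (γ, γ') ∂(Q : Measure Γ) := by
  calc L γ = ∫⁻ _γ', L γ ∂(Q : Measure Γ) := by simp
    _ ≤ _ := lintegral_mono fun γ' => g.le_pair γ γ'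

omit [MetrizableSpace X] [SecondCountableTopology X] [MeasurableSpace X] [BorelSpace X] in
lemma isCompact_marginal_sublevel (Q : ProbabilityMeasure Γ) (R : ℝ≥0) :
    IsCompact {γ | ∫⁻ γ', G (γ, γ') ∂(Q : Measure Γ) ≤ R} :=
  (g.isCompact_sublevel R).of_isClosed_subset
    ((g.lsc_marginal Q).isClosed_preimage (R : ℝ≥0∞))
    fun γ hγ => (g.cost_le_marginal Q γ).trans hγ

omit [SecondCountableTopology Γ]
  [MetrizableSpace X] [SecondCountableTopology X] [MeasurableSpace X] [BorelSpace X] in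
lemma pairEnergy_le (Q Q' : ProbabilityMeasure Γ) :
    pairEnergy G Q Q' ≤
      K₁ + K₂ * (∫⁻ γ, L γ ∂(Q : Measure Γ) + ∫⁻ γ, L γ ∂(Q' : Measure Γ)) := by
  have hL := g.lsc_cost.measurable
  calc pairEnergy G Q Q' ≤ ∫⁻ γ, ∫⁻ γ', (K₁ + K₂ * (L γ + L γ')) ∂(Q' : Measure Γ)
        ∂(Q : Measure Γ) := lintegral_mono fun γ => lintegral_mono fun γ' => g.pair_le γ γ'
    _ = _ := by
      have h1 : ∀ γ, ∫⁻ γ', (K₁ + K₂ * (L γ + L γ') : ℝ≥0∞) ∂(Q' : Measure Γ) =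
          K₁ + K₂ * (L γ + ∫⁻ γ', L γ' ∂(Q' : Measure Γ)) := by
        intro γ
        rw [lintegral_add_left measurable_const, lintegral_const_mul _ (hL.const_add _),
          lintegral_add_left measurable_const]
        simp
      simp only [h1]
      rw [lintegral_add_left measurable_const, lintegral_const_mul _ (hL.add_const _),
        lintegral_add_right _ measurable_const]
      simp

omit [MetrizableSpace Γ] [SecondCountableTopology Γ] [BorelSpace Γ] [MetrizableSpace X]
  [SecondCountableTopology X] [MeasurableSpace X] [BorelSpace X] in
lemma lintegral_cost_le_pairEnergy (Q : ProbabilityMeasure Γ) :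
    ∫⁻ γ, L γ ∂(Q : Measure Γ) ≤ pairEnergy G Q Q :=
  lintegral_mono fun γ => g.cost_le_marginal Q γ

/-- Among the laws with a prescribed initial distribution there is one of least energy. -/
lemma exists_minimizer (m₀ : ProbabilityMeasure X) :
    ∃ Q : ProbabilityMeasure Γ, (Q : Measure Γ).map e = m₀ ∧ pairEnergy G Q Q < ⊤ ∧
      ∀ Q' : ProbabilityMeasure Γ, (Q' : Measure Γ).map e = m₀ →
        pairEnergy G Q Q ≤ pairEnergy G Q' Q' := by
  have hL := g.lsc_cost.measurable
  -- a competitor of finite energy, carried by the curves of individual cost at most `κ`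
  have hsurj : (m₀ : Measure X) (e '' {γ | L γ ≤ κ})ᶜ = 0 := by
    have : e '' {γ | L γ ≤ κ} = univ := by
      refine eq_univ_of_forall fun x => ?_
      obtain ⟨γ, hγ, hγ'⟩ := g.access x
      exact ⟨γ, hγ', hγ⟩
    simp [this]
  obtain ⟨ν, hν, hνK, hνm⟩ := exists_measure_map_eq_of_isCompact g.continuous_start
    (g.isCompact_sublevel κ) (m₀ : Measure X) hsurj
  have hνp : IsProbabilityMeasure ν := by
    have : IsProbabilityMeasure (ν.map e) := by rw [hνm]; infer_instance
    exact Measure.isProbabilityMeasure_of_map e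
  let Q₀ : ProbabilityMeasure Γ := ⟨ν, hνp⟩
  have hQ₀ : ∫⁻ γ, L γ ∂(Q₀ : Measure Γ) ≤ κ := by
    calc ∫⁻ γ, L γ ∂ν ≤ ∫⁻ _γ, κ ∂ν := by
          refine lintegral_mono_ae ?_
          have : {γ | L γ ≤ κ} ∈ ae ν := by rwa [mem_ae_iff]
          exact this
      _ = κ := by simp
  have hJ₀ : pairEnergy G Q₀ Q₀ < ⊤ := by
    refine (g.pairEnergy_le Q₀ Q₀).trans_lt ?_
    have : ∫⁻ γ, L γ ∂(Q₀ : Measure Γ) < ⊤ := hQ₀.trans_lt ENNReal.coe_lt_top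
    finiteness
  set J₀ := (pairEnergy G Q₀ Q₀).toNNReal with hJ₀def
  have hJ₀' : (J₀ : ℝ≥0∞) = pairEnergy G Q₀ Q₀ := ENNReal.coe_toNNReal hJ₀.ne
  have hJlsc : LowerSemicontinuous fun Q : ProbabilityMeasure Γ => pairEnergy G Q Q := by
    have h1 := lowerSemicontinuous_lintegral g.lsc_pair
    have h2 : Continuous fun Q : ProbabilityMeasure Γ => Q.prod Q :=
      ProbabilityMeasure.continuous_prod.comp (continuous_id.prodMk continuous_id)
    have h3 : ∀ Q : ProbabilityMeasure Γ,
        pairEnergy G Q Q = ∫⁻ z, G z ∂(Q.prod Q : Measure (Γ × Γ)) := fun Q =>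
      (lintegral_prod _ g.lsc_pair.measurable.aemeasurable).symm
    simp only [h3]
    exact h1.comp h2
  let S : Set (ProbabilityMeasure Γ) :=
    {Q | (Q : Measure Γ).map e = m₀ ∧ pairEnergy G Q Q ≤ J₀}
  have hSclosed : IsClosed S := by
    refine IsClosed.inter ?_ (hJlsc.isClosed_preimage (J₀ : ℝ≥0∞))
    have : {Q : ProbabilityMeasure Γ | (Q : Measure Γ).map e = m₀} =
        (fun Q : ProbabilityMeasure Γ => Q.map g.continuous_start.aemeasurable) ⁻¹' {m₀} := by
      ext Q
      simp only [mem_ofPred_eq, mem_preimage, mem_singleton_iff]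
      exact ⟨fun h => Subtype.ext h,
        fun h => congrArg (fun P : ProbabilityMeasure X => (P : Measure X)) h⟩
    show IsClosed {Q : ProbabilityMeasure Γ | (Q : Measure Γ).map e = m₀}
    rw [this]
    exact isClosed_singleton.preimage (ProbabilityMeasure.continuous_map g.continuous_start)
  -- Prokhorov: by Markov's inequality the laws in `S` are tight
  have hScompact : IsCompact S := by
    let u : ℕ → ℝ≥0 := fun n => J₀ / ((n : ℝ≥0) + 1)
    have hu : Tendsto u atTop (𝓝 0) :=
      (tendsto_const_div_atTop_nhds_zero_nat J₀).comp (tendsto_add_atTop_nat 1) |>.congr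
        fun n => by simp [u]
    refine (isCompact_setOfPred_probabilityMeasure_mass_eq_compl_isCompact_le (u := u)
      (K := fun n => {γ | L γ ≤ ((n : ℝ≥0) + 1 : ℝ≥0)}) hu (fun n => g.isCompact_sublevel _)
      (Or.inr ?_)).of_isClosed_subset hSclosed ?_
    · intro m n hmn γ hγ
      have hle : ((m : ℝ≥0) + 1 : ℝ≥0) ≤ (n : ℝ≥0) + 1 := by gcongr
      exact (show L γ ≤ ((m : ℝ≥0) + 1 : ℝ≥0) from hγ).trans (ENNReal.coe_le_coe.2 hle)
    · intro Q hQ n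
      rw [← ENNReal.coe_le_coe, ProbabilityMeasure.ennreal_coeFn_eq_coeFn_toMeasure]
      have hpos : (((n : ℝ≥0) + 1 : ℝ≥0) : ℝ≥0∞) ≠ 0 := by
        exact_mod_cast Nat.succ_ne_zero n
      calc (Q : Measure Γ) {γ | L γ ≤ ((n : ℝ≥0) + 1 : ℝ≥0)}ᶜ
          ≤ (Q : Measure Γ) {γ | (((n : ℝ≥0) + 1 : ℝ≥0) : ℝ≥0∞) ≤ L γ} :=
            measure_mono fun γ hγ => (not_le.1 (show ¬ L γ ≤ _ from hγ)).le
        _ ≤ (∫⁻ γ, L γ ∂(Q : Measure Γ)) / ((n : ℝ≥0) + 1 : ℝ≥0) :=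
            meas_ge_le_lintegral_div hL.aemeasurable hpos ENNReal.coe_ne_top
        _ ≤ J₀ / ((n : ℝ≥0) + 1 : ℝ≥0) := by
            gcongr
            exact (g.lintegral_cost_le_pairEnergy Q).trans hQ.2
        _ = (u n : ℝ≥0∞) := by
            rw [ENNReal.coe_div]
            exact_mod_cast hpos
  have hSne : S.Nonempty := ⟨Q₀, hνm, hJ₀'.ge⟩
  obtain ⟨Q, hQS, hQmin⟩ := (hJlsc.lowerSemicontinuousOn S).exists_isMinOn hSne hScompact
  refine ⟨Q, hQS.1, hQS.2.trans_lt ENNReal.coe_lt_top, fun Q' hQ' => ?_⟩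
  by_cases h : pairEnergy G Q' Q' ≤ J₀
  · exact hQmin ⟨hQ', h⟩
  · exact hQS.2.trans (not_le.1 h).le

omit [MetrizableSpace X] [SecondCountableTopology X] in
/-- First-order optimality: along the segment from a minimizer `Q` to a competitor `Q'` the energy
is a quadratic polynomial, whose derivative at `Q` is nonnegative. -/
lemma first_variation {m₀ : ProbabilityMeasure X} {Q Q' : ProbabilityMeasure Γ}
    (hQ : (Q : Measure Γ).map e = m₀) (hfin : pairEnergy G Q Q < ⊤)
    (hmin : ∀ Q' : ProbabilityMeasure Γ, (Q' : Measure Γ).map e = m₀ →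
        pairEnergy G Q Q ≤ pairEnergy G Q' Q')
    (hQ' : (Q' : Measure Γ).map e = m₀) (hfin' : ∫⁻ γ, L γ ∂(Q' : Measure Γ) < ⊤) :
    pairEnergy G Q Q ≤ pairEnergy G Q' Q := by
  have hLQ : ∫⁻ γ, L γ ∂(Q : Measure Γ) < ⊤ := (g.lintegral_cost_le_pairEnergy Q).trans_lt hfin
  have hA : pairEnergy G Q Q ≠ ⊤ := hfin.ne
  have hB : pairEnergy G Q Q' ≠ ⊤ := by
    refine ((g.pairEnergy_le Q Q').trans_lt ?_).ne
    finiteness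
  have hD : pairEnergy G Q' Q' ≠ ⊤ := by
    refine ((g.pairEnergy_le Q' Q').trans_lt ?_).ne
    finiteness
  rw [pairEnergy_comm g.lsc_pair g.symm (Q' : Measure Γ) Q]
  have key : ∀ s : ℝ, 0 < s → s ≤ 1 →
      (pairEnergy G Q Q).toReal ≤ (1 - s) * (1 - s) * (pairEnergy G Q Q).toReal +
        2 * ((1 - s) * s) * (pairEnergy G Q Q').toReal + s * s * (pairEnergy G Q' Q').toReal := by
    intro s hs hs1
    obtain ⟨a, ha⟩ : ∃ a : ℝ≥0, (a : ℝ) = 1 - s := ⟨⟨1 - s, by linarith⟩, rfl⟩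
    obtain ⟨b, hb⟩ : ∃ b : ℝ≥0, (b : ℝ) = s := ⟨⟨s, hs.le⟩, rfl⟩
    have hab : a + b = 1 := by
      apply NNReal.eq
      push_cast
      rw [ha, hb]
      ring
    have hp : IsProbabilityMeasure (a • (Q : Measure Γ) + b • (Q' : Measure Γ)) := by
      constructor
      rw [Measure.add_apply, Measure.smul_apply, Measure.smul_apply, measure_univ, measure_univ,
        ← add_smul, hab, one_smul]
    have hm : (a • (Q : Measure Γ) + b • (Q' : Measure Γ)).map e = m₀ := by
      rw [Measure.map_add _ _ g.continuous_start.measurable, Measure.map_smul, Measure.map_smul, hQ,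
        hQ', ← add_smul, hab, one_smul]
    have h1 := hmin ⟨_, hp⟩ hm
    change pairEnergy G Q Q ≤ pairEnergy G (a • (Q : Measure Γ) + b • (Q' : Measure Γ))
      (a • (Q : Measure Γ) + b • (Q' : Measure Γ)) at h1
    rw [pairEnergy_combo g.lsc_pair g.symm] at h1
    have h2 := ENNReal.toReal_mono (by finiteness) h1
    rw [ENNReal.toReal_add (by finiteness) (by finiteness),
      ENNReal.toReal_add (by finiteness) (by finiteness)] at h2
    simpa only [ENNReal.toReal_mul, ENNReal.coe_toReal, ENNReal.toReal_ofNat, ha, hb] using h2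
  rw [← ENNReal.toReal_le_toReal hA hB]
  set A := (pairEnergy G Q Q).toReal
  set B := (pairEnergy G Q Q').toReal
  set D := (pairEnergy G Q' Q').toReal
  by_contra! hlt
  have hD0 : 0 ≤ D := ENNReal.toReal_nonneg
  have hB0 : 0 ≤ B := ENNReal.toReal_nonneg
  -- dividing by `s`: `2 (A - B) ≤ s (A - 2 B + D)`, violated for small `s`
  have hs0 : 0 < (A - B) / (A + D + 1) := by
    apply div_pos <;> linarith
  have hs1 : (A - B) / (A + D + 1) ≤ 1 := by
    rw [div_le_one (by linarith)]
    linarith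
  have hk := key _ hs0 hs1
  set s := (A - B) / (A + D + 1) with hsdef
  have hsm : s * (A + D + 1) = A - B := by
    rw [hsdef, div_mul_cancel₀ _ (by linarith)]
  have h3 : 0 ≤ s * (s * (A - 2 * B + D) - 2 * (A - B)) := by nlinarith
  have h4 : 0 ≤ s * (A - 2 * B + D) - 2 * (A - B) := nonneg_of_mul_nonneg_right h3 hs0
  nlinarith

/-- A minimizer of the energy is an equilibrium. If the curves in
`B = {F > r} ∩ e ⁻¹' (e '' {F ≤ r})` had positive mass, transporting that mass onto the compact set
`{F ≤ r}` without changing the initial positions would decrease the linearized energy. -/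
lemma ae_optimal {m₀ : ProbabilityMeasure X} {Q : ProbabilityMeasure Γ}
    (hQ : (Q : Measure Γ).map e = m₀) (hfin : pairEnergy G Q Q < ⊤)
    (hmin : ∀ Q' : ProbabilityMeasure Γ, (Q' : Measure Γ).map e = m₀ →
        pairEnergy G Q Q ≤ pairEnergy G Q' Q') :
    ∀ᵐ γ ∂(Q : Measure Γ), ∀ ω, e ω = e γ →
      ∫⁻ γ', G (γ, γ') ∂(Q : Measure Γ) ≤ ∫⁻ γ', G (ω, γ') ∂(Q : Measure Γ) := by
  set F : Γ → ℝ≥0∞ := fun γ => ∫⁻ γ', G (γ, γ') ∂(Q : Measure Γ) with hF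
  have hFm : Measurable F := (g.lsc_marginal Q).measurable
  have hem := g.continuous_start.measurable
  have hnull : ∀ r : ℝ≥0, (Q : Measure Γ) ({γ | (r : ℝ≥0∞) < F γ} ∩
      e ⁻¹' (e '' {γ | F γ ≤ r})) = 0 := by
    intro r
    have hK : IsCompact {γ | F γ ≤ r} := g.isCompact_marginal_sublevel Q r
    have hKe := (hK.image g.continuous_start).isClosed.measurableSet
    set B := {γ | (r : ℝ≥0∞) < F γ} ∩ e ⁻¹' (e '' {γ | F γ ≤ r}) with hBdef
    have hBm : MeasurableSet B := (measurableSet_lt measurable_const hFm).inter (hem hKe)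
    by_contra hpos
    obtain ⟨ν, hν, hνK, hνm⟩ := exists_measure_map_eq_of_isCompact g.continuous_start hK
      (((Q : Measure Γ).restrict B).map e) (by
        rw [Measure.map_apply hem hKe.compl, Measure.restrict_apply (hem hKe.compl)]
        refine measure_mono_null ?_ measure_empty
        rintro γ ⟨h1, h2⟩
        exact h1 h2.2)
    have hνmass : ν univ = (Q : Measure Γ) B := by
      have := congrArg (fun μ : Measure X => μ univ) hνm
      simpa [Measure.map_apply hem MeasurableSet.univ] using this
    have hm : ((Q : Measure Γ).restrict Bᶜ + ν).map e = m₀ := by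
      rw [Measure.map_add _ _ hem, hνm, ← Measure.map_add _ _ hem, add_comm,
        Measure.restrict_add_restrict_compl hBm, hQ]
    have hp : IsProbabilityMeasure ((Q : Measure Γ).restrict Bᶜ + ν) := by
      have : IsProbabilityMeasure (((Q : Measure Γ).restrict Bᶜ + ν).map e) := by
        rw [hm]; infer_instance
      exact Measure.isProbabilityMeasure_of_map e
    have hνF : ∫⁻ γ, F γ ∂ν ≤ r * (Q : Measure Γ) B := by
      calc ∫⁻ γ, F γ ∂ν ≤ ∫⁻ _γ, r ∂ν := by
            refine lintegral_mono_ae ?_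
            have : {γ | F γ ≤ r} ∈ ae ν := by rwa [mem_ae_iff]
            exact this
        _ = r * (Q : Measure Γ) B := by rw [lintegral_const, hνmass]
    have hFQ : ∫⁻ γ, F γ ∂(Q : Measure Γ) < ⊤ := hfin
    have hFc : ∫⁻ γ in Bᶜ, F γ ∂(Q : Measure Γ) ≠ ⊤ :=
      ((setLIntegral_le_lintegral _ _).trans_lt hFQ).ne
    have hQB : (Q : Measure Γ) B ≠ ⊤ := measure_ne_top _ _
    have hLfin : ∫⁻ γ, L γ ∂((Q : Measure Γ).restrict Bᶜ + ν) < ⊤ := by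
      calc ∫⁻ γ, L γ ∂((Q : Measure Γ).restrict Bᶜ + ν)
          ≤ ∫⁻ γ, F γ ∂((Q : Measure Γ).restrict Bᶜ + ν) :=
            lintegral_mono fun γ => g.cost_le_marginal Q γ
        _ ≤ ∫⁻ γ in Bᶜ, F γ ∂(Q : Measure Γ) + r * (Q : Measure Γ) B := by
            rw [lintegral_add_measure]
            gcongr
        _ < ⊤ := by finiteness
    have hle := g.first_variation (Q' := ⟨_, hp⟩) hQ hfin hmin hm hLfin
    have hle' : ∫⁻ γ, F γ ∂(Q : Measure Γ) ≤ ∫⁻ γ in Bᶜ, F γ ∂(Q : Measure Γ) + ∫⁻ γ, F γ ∂ν := by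
      rw [← lintegral_add_measure]
      exact hle
    rw [← lintegral_add_compl F hBm, add_comm] at hle'
    have hle2 := (ENNReal.add_le_add_iff_left hFc).1 hle'
    -- on `B` the strict inequality `r < F` integrates to a strict inequality
    have hstrict : r * (Q : Measure Γ) B < ∫⁻ γ in B, F γ ∂(Q : Measure Γ) := by
      have : ∫⁻ _γ in B, (r : ℝ≥0∞) ∂(Q : Measure Γ) < ∫⁻ γ in B, F γ ∂(Q : Measure Γ) := by
        refine setLIntegral_strict_mono hBm hpos hFm ?_ ?_
        · rw [setLIntegral_const]
          finiteness
        · exact Eventually.of_forall fun γ hγ => hγ.1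
      rwa [setLIntegral_const] at this
    exact absurd (hle2.trans hνF) (not_le.2 hstrict)
  -- rational levels suffice to separate the marginal costs of two curves
  have hall : ∀ᵐ γ ∂(Q : Measure Γ), ∀ q : ℚ,
      γ ∉ {γ | ((Real.toNNReal q : ℝ≥0) : ℝ≥0∞) < F γ} ∩
        e ⁻¹' (e '' {γ | F γ ≤ (Real.toNNReal q : ℝ≥0)}) := by
    rw [ae_all_iff]
    intro q
    exact measure_eq_zero_iff_ae_notMem.1 (hnull _)
  filter_upwards [hall] with γ hγ ω hω
  by_contra! hlt
  obtain ⟨q, -, hq1, hq2⟩ := ENNReal.lt_iff_exists_rat_btwn.1 hlt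
  exact hγ q ⟨hq2, ω, hq1.le, hω⟩

end PairGame

end

/-! ### Lower semicontinuity of convex integral functionals -/

/-- Composing a Carathéodory function with a measurable map gives a measurable function. -/
lemma aemeasurable_comp_of_continuous {T Z : Type*} [MeasurableSpace T] {μ : Measure T}
    [TopologicalSpace Z] [MetrizableSpace Z] [SecondCountableTopology Z] [MeasurableSpace Z]
    [BorelSpace Z] {f : T → Z → ℝ≥0} (hm : ∀ z, AEMeasurable (fun t => f t z) μ)
    (hc : ∀ᵐ t ∂μ, Continuous (f t)) {z : T → Z} (hz : Measurable z) :
    AEMeasurable (fun t => f t (z t)) μ := by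
  have hsm := hz.stronglyMeasurable
  have hsimple : ∀ s : SimpleFunc T Z, AEMeasurable (fun t => f t (s t)) μ := by
    intro s
    have hcov : (⋃ y : s.range, s ⁻¹' {(y : Z)}) = univ := by
      refine eq_univ_of_forall fun t => mem_iUnion.2 ⟨⟨s t, s.mem_range_self t⟩, rfl⟩
    rw [← Measure.restrict_univ (μ := μ), ← hcov, aemeasurable_iUnion_iff]
    intro y
    refine (hm y).restrict.congr ?_
    filter_upwards [ae_restrict_mem (s.measurableSet_preimage {(y : Z)})] with t ht
    rw [show s t = y from ht]
  refine aemeasurable_of_tendsto_metrizable_ae atTop (fun n => hsimple (hsm.approx n)) ?_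
  filter_upwards [hc] with t ht
  exact (ht.tendsto _).comp (hsm.tendsto_approx t)

/-- Hölder's inequality on a set, for a function whose `θ`-th power is integrable. -/
lemma setLIntegral_enorm_le {T V : Type*} [MeasurableSpace T] {μ : Measure T}
    [NormedAddCommGroup V] {v : T → V} {θ : ℝ} (hθ : 1 < θ)
    (hv : AEStronglyMeasurable v μ) (E : Set T) :
    ∫⁻ t in E, ‖v t‖ₑ ∂μ ≤ (∫⁻ t, ‖v t‖ₑ ^ θ ∂μ) ^ (1 / θ) * μ E ^ (1 - 1 / θ) := by
  have h := eLpNorm'_le_eLpNorm'_mul_rpow_measure_univ (μ := μ.restrict E) (f := v) zero_lt_one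
    hθ.le hv.restrict
  simp only [eLpNorm', ENNReal.rpow_one, div_one, Measure.restrict_apply_univ] at h
  refine h.trans ?_
  gcongr
  exact Measure.restrict_le_self

/-- A jointly continuous function, convex and superlinear in its second variable, is near every
point the supremum of the affine functions below it whose linear part is taken from a dense
sequence and whose constant is rational, and these remain below it on an open set of first
variables. Superlinearity is what allows perturbing the slope. -/
lemma exists_affine_le_near {X V : Type*} [TopologicalSpace X]
    [NormedAddCommGroup V] [NormedSpace ℝ V] [FiniteDimensional ℝ V]
    {φ : X → V → ℝ} (hc : Continuous fun z : X × V => φ z.1 z.2) {x : X}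
    (hconv : ConvexOn ℝ univ (φ x)) {α θ : ℝ} (hα : 0 < α) (hθ : 1 < θ)
    (hlow : ∀ y q, α * ‖q‖ ^ θ ≤ φ y q) {l : ℕ → V →L[ℝ] ℝ} (hl : DenseRange l)
    {p : V} {a : ℝ} (ha : a < φ x p) :
    ∃ (i : ℕ) (c : ℚ) (U : Set X), IsOpen U ∧ x ∈ U ∧ (∀ y ∈ U, ∀ q, l i q + c ≤ φ y q) ∧
      a < l i p + c := by
  obtain ⟨a', haa', ha'⟩ := exists_between ha
  have hcx : Continuous (φ x) := hc.comp (continuous_const.prodMk continuous_id)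
  obtain ⟨l₀, c₀, hle, heq⟩ := ConvexOn.exists_affine_le_of_lt (𝕜 := ℝ) (mem_univ p) ha'
    isClosed_univ (hcx.lowerSemicontinuous.lowerSemicontinuousOn _) hconv
  have hle' : ∀ q, l₀ q + c₀ ≤ φ x q := fun q => by simpa using hle ⟨q, mem_univ q⟩
  have heq' : l₀ p + c₀ = a' := by simpa using heq
  have hη : 0 < (a' - a) / 4 := by linarith
  set η := (a' - a) / 4 with hηdef
  -- beyond radius `r` the growth of `φ` dominates all the affine functions in question
  have hgrow : ∀ᶠ r : ℝ in atTop, (‖l₀‖ + 1 + |c₀|) ≤ α * r ^ (θ - 1) :=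
    ((tendsto_rpow_atTop (by linarith : 0 < θ - 1)).const_mul_atTop hα).eventually_ge_atTop _
  obtain ⟨r₁, hr₁⟩ := eventually_atTop.1 hgrow
  set r := max (max r₁ 1) ‖p‖ with hr
  have hr1 : 1 ≤ r := (le_max_right _ _).trans (le_max_left _ _)
  have hrp : ‖p‖ ≤ r := le_max_right _ _
  obtain ⟨i, hi⟩ := hl.exists_dist_lt l₀ (ε := min 1 (η / r)) (by positivity)
  have hi1 : ‖l i - l₀‖ ≤ 1 := by
    rw [← dist_eq_norm, dist_comm]; exact hi.le.trans (min_le_left _ _)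
  have hi2 : ‖l i - l₀‖ ≤ η / r := by
    rw [← dist_eq_norm, dist_comm]; exact hi.le.trans (min_le_right _ _)
  obtain ⟨c, hc1, hc2⟩ := exists_rat_btwn (show c₀ - 3 * η < c₀ - 2 * η by linarith)
  have hball : ∀ q, ‖q‖ ≤ r → |l i q - l₀ q| ≤ η := by
    intro q hq
    calc |l i q - l₀ q| = ‖(l i - l₀) q‖ := by simp
      _ ≤ ‖l i - l₀‖ * ‖q‖ := (l i - l₀).le_opNorm q
      _ ≤ η / r * r := by gcongr
      _ = η := by field_simp
  have hopen : IsOpen {z : X × V | l i z.2 + c < φ z.1 z.2} :=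
    isOpen_lt (by fun_prop) hc
  obtain ⟨U, W, hU, -, hxU, hW, hUW⟩ := generalized_tube_lemma (isCompact_singleton (x := x))
    (isCompact_closedBall (0 : V) r) hopen (by
      rintro ⟨y, q⟩ ⟨hy, hq⟩
      rw [mem_singleton_iff] at hy
      subst hy
      have h1 := abs_le.1 (hball q (by simpa using hq))
      have h2 := hle' q
      show l i q + c < φ y q
      linarith [h1.2])
  refine ⟨i, c, U, hU, hxU rfl, fun y hy q => ?_, ?_⟩
  · by_cases hq : ‖q‖ ≤ r
    · exact (hUW (mk_mem_prod hy (hW (by simpa using hq))) : l i q + c < φ y q).le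
    · push Not at hq
      refine le_trans ?_ (hlow y q)
      have hq1 : 1 ≤ ‖q‖ := hr1.trans hq.le
      have h1 : l i q ≤ (‖l₀‖ + 1) * ‖q‖ := by
        calc l i q ≤ ‖l i q‖ := Real.le_norm_self _
          _ ≤ ‖l i‖ * ‖q‖ := (l i).le_opNorm q
          _ ≤ (‖l₀‖ + 1) * ‖q‖ := by
            gcongr
            calc ‖l i‖ = ‖l₀ + (l i - l₀)‖ := by congr 1; abel
              _ ≤ ‖l₀‖ + ‖l i - l₀‖ := norm_add_le _ _
              _ ≤ ‖l₀‖ + 1 := by gcongr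
      have h2 : (c : ℝ) ≤ |c₀| * ‖q‖ := by
        have : |c₀| * 1 ≤ |c₀| * ‖q‖ := by gcongr
        linarith [le_abs_self c₀]
      have h3 := hr₁ ‖q‖ (((le_max_left _ _).trans (le_max_left _ _)).trans hq.le)
      have h4 : ‖q‖ ^ θ = ‖q‖ ^ (θ - 1) * ‖q‖ := by
        rw [← Real.rpow_add_one (by linarith)]
        congr 1
        ring
      rw [h4, ← mul_assoc]
      calc l i q + c ≤ (‖l₀‖ + 1) * ‖q‖ + |c₀| * ‖q‖ := add_le_add h1 h2
        _ = (‖l₀‖ + 1 + |c₀|) * ‖q‖ := by ring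
        _ ≤ _ := by gcongr
  · have h1 := abs_le.1 (hball p hrp)
    have : a' = a + 4 * η := by rw [hηdef]; ring
    linarith [h1.1]

/-- A nonnegative integrand `f t x p` which is measurable in `t`, jointly continuous in `(x, p)`,
and convex and superlinear in the velocity `p`. -/
structure IsConvexIntegrand {T X V : Type*} [MeasurableSpace T] [TopologicalSpace X]
    [NormedAddCommGroup V] [NormedSpace ℝ V] (μ : Measure T) (f : T → X → V → ℝ≥0)
    (α θ : ℝ) : Prop where
  aemeasurable : ∀ x p, AEMeasurable (fun t => f t x p) μ
  continuous : ∀ᵐ t ∂μ, Continuous fun z : X × V => f t z.1 z.2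
  convex : ∀ᵐ t ∂μ, ∀ x, ConvexOn ℝ univ fun p => (f t x p : ℝ)
  pos : 0 < α
  one_lt : 1 < θ
  lower : ∀ t x p, α * ‖p‖ ^ θ ≤ f t x p

section

variable {T X V : Type*} [MeasurableSpace T] {μ : Measure T}
  [TopologicalSpace X] [MetrizableSpace X] [SecondCountableTopology X]
  [MeasurableSpace X] [BorelSpace X]
  [NormedAddCommGroup V] [NormedSpace ℝ V] [FiniteDimensional ℝ V] [MeasurableSpace V]
  [BorelSpace V]
  {f : T → X → V → ℝ≥0} {α θ : ℝ}

lemma IsConvexIntegrand.aemeasurable_comp (hf : IsConvexIntegrand μ f α θ) {x : T → X} {v : T → V}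
    (hx : Measurable x) (hv : Measurable v) : AEMeasurable (fun t => f t (x t) (v t)) μ :=
  have := FiniteDimensional.proper ℝ V
  aemeasurable_comp_of_continuous (f := fun t (z : X × V) => f t z.1 z.2)
    (fun z => hf.aemeasurable z.1 z.2) hf.continuous (hx.prodMk hv)

omit [MetrizableSpace X] [MeasurableSpace X] [BorelSpace X] [MeasurableSpace V] [BorelSpace V] in
/-- A convex integrand is, for almost every `t`, the supremum of countably many functions
`1_A(t) 1_B(x) (l p + c)` with `A` measurable and `B` open. -/
lemma IsConvexIntegrand.exists_affine_family (hf : IsConvexIntegrand μ f α θ) :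
    ∃ (l : ℕ → V →L[ℝ] ℝ) (c : ℕ → ℝ) (B : ℕ → Set X) (A : ℕ → Set T),
      (∀ j, IsOpen (B j)) ∧ (∀ j, MeasurableSet (A j)) ∧
      (∀ᵐ t ∂μ, ∀ j, t ∈ A j → ∀ x ∈ B j, ∀ p, l j p + c j ≤ f t x p) ∧
      (∀ᵐ t ∂μ, ∀ x p a, a < (f t x p : ℝ) → ∃ j, t ∈ A j ∧ x ∈ B j ∧ a < l j p + c j) := by
  have := FiniteDimensional.proper ℝ V
  have := FiniteDimensional.proper ℝ (V →L[ℝ] ℝ)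
  obtain ⟨b, hb⟩ := ((countable_countableBasis X).insert ∅).exists_eq_range (insert_nonempty _ _)
  obtain ⟨idx, hidx⟩ := exists_surjective_nat (ℕ × ℚ × ℕ)
  let l : ℕ → V →L[ℝ] ℝ := fun j => denseSeq _ (idx j).1
  let c : ℕ → ℝ := fun j => ((idx j).2.1 : ℝ)
  let B : ℕ → Set X := fun j => b (idx j).2.2
  have hBopen : ∀ j, IsOpen (B j) := by
    intro j
    have : B j ∈ insert ∅ (countableBasis X) := hb ▸ mem_range_self _
    rcases this with h | h
    · rw [h]; exact isOpen_empty
    · exact isOpen_of_mem_countableBasis h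
  obtain ⟨SX, hSXc, hSXd⟩ := exists_countable_dense X
  obtain ⟨SV, hSVc, hSVd⟩ := exists_countable_dense V
  -- by density, the inequality need only be tested on countably many points
  let A' : ℕ → Set T := fun j => ⋂ x ∈ SX ∩ B j, ⋂ p ∈ SV, {t | l j p + c j ≤ f t x p}
  have hA'null : ∀ j, NullMeasurableSet (A' j) μ := by
    intro j
    refine .biInter (hSXc.mono inter_subset_left) fun x _ => .biInter hSVc fun p _ => ?_
    exact nullMeasurableSet_le aemeasurable_const (hf.aemeasurable x p).coe_nnreal_real
  have hA'iff : ∀ᵐ t ∂μ, ∀ j, t ∈ A' j ↔ ∀ x ∈ B j, ∀ p, l j p + c j ≤ f t x p := by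
    filter_upwards [hf.continuous] with t ht j
    constructor
    · intro h x hx p
      have hcl : IsClosed {z : X × V | l j z.2 + c j ≤ f t z.1 z.2} :=
        isClosed_le (by fun_prop) (NNReal.continuous_coe.comp ht)
      have hsub : (SX ∩ B j) ×ˢ SV ⊆ {z : X × V | l j z.2 + c j ≤ f t z.1 z.2} := by
        rintro ⟨y, q⟩ ⟨hy, hq⟩
        have := mem_iInter₂.1 h y hy
        exact mem_iInter₂.1 this q hq
      have hmem : (x, p) ∈ closure ((SX ∩ B j) ×ˢ SV) := by
        rw [closure_prod_eq]
        refine ⟨?_, hSVd p⟩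
        rw [inter_comm]
        exact hSXd.open_subset_closure_inter (hBopen j) hx
      exact hcl.closure_subset_iff.2 hsub hmem
    · intro h
      exact mem_iInter₂.2 fun x hx => mem_iInter₂.2 fun p _ => h x hx.2 p
  choose A hAsub hAm hAae using fun j => (hA'null j).exists_measurable_subset_ae_eq
  have hAiff : ∀ᵐ t ∂μ, ∀ j, t ∈ A j ↔ t ∈ A' j := by
    rw [ae_all_iff]
    exact fun j => (hAae j).mem_iff
  refine ⟨l, c, B, A, hBopen, hAm, ?_, ?_⟩
  · filter_upwards [hA'iff] with t ht j htA
    exact (ht j).1 (hAsub j htA)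
  · filter_upwards [hA'iff, hAiff, hf.continuous, hf.convex] with t ht ht' hct hvt x p a ha
    obtain ⟨i, q, U, hU, hxU, hle, hlt⟩ := exists_affine_le_near
      (φ := fun x p => (f t x p : ℝ)) (NNReal.continuous_coe.comp hct) (hvt x) hf.pos hf.one_lt
      (hf.lower t) (denseRange_denseSeq (V →L[ℝ] ℝ)) ha
    obtain ⟨W, hW, hxW, hWU⟩ := (isBasis_countableBasis X).exists_subset_of_mem_open hxU hU
    obtain ⟨k, hk⟩ : W ∈ range b := hb ▸ mem_insert_of_mem _ hW
    obtain ⟨j, hj⟩ := hidx (i, q, k)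
    have hBj : B j = W := by simp only [B, hj, hk]
    have hlj : l j = denseSeq (V →L[ℝ] ℝ) i := by simp only [l, hj]
    have hcj : c j = q := by simp only [c, hj]
    refine ⟨j, (ht' j).2 ((ht j).2 ?_), hBj ▸ hxW, ?_⟩
    · intro y hy p'
      rw [hlj, hcj]
      exact hle y (hWU (hBj ▸ hy)) p'
    · rw [hlj, hcj]
      exact hlt

lemma ofReal_integral_le_lintegral {g : T → ℝ} (hg : Integrable g μ) :
    ENNReal.ofReal (∫ t, g t ∂μ) ≤ ∫⁻ t, ENNReal.ofReal (g t) ∂μ := by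
  calc ENNReal.ofReal (∫ t, g t ∂μ) ≤ ENNReal.ofReal (∫ t, max (g t) 0 ∂μ) :=
        ENNReal.ofReal_le_ofReal (integral_mono hg hg.pos_part fun t => le_max_left _ _)
    _ = ∫⁻ t, ENNReal.ofReal (max (g t) 0) ∂μ :=
        ofReal_integral_eq_lintegral_ofReal hg.pos_part
          (Eventually.of_forall fun t => le_max_right _ _)
    _ = _ := by simp

/-- Weak convergence of velocities `vₙ ⇀ v`, in the form used for lower semicontinuity: bounded
`θ`-energy together with convergence of the integrals of all coordinates on all measurable sets. -/
structure VelocityTendsto (μ : Measure T) (θ : ℝ) (vn : ℕ → T → V) (v : T → V) : Prop where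
  measurable_seq : ∀ n, Measurable (vn n)
  measurable_lim : Measurable v
  bound : ∃ R : ℝ≥0, ∀ n, ∫⁻ t, ‖vn n t‖ₑ ^ θ ∂μ ≤ R
  integrable_lim : ∀ l : V →L[ℝ] ℝ, Integrable (fun t => l (v t)) μ
  tendsto : ∀ D, MeasurableSet D → ∀ l : V →L[ℝ] ℝ,
    Tendsto (fun n => ∫ t in D, l (vn n t) ∂μ) atTop (𝓝 (∫ t in D, l (v t) ∂μ))

lemma VelocityTendsto.integrable_seq [IsFiniteMeasure μ] {vn : ℕ → T → V} {v : T → V}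
    (hv : VelocityTendsto μ θ vn v) (hθ : 1 < θ) (n : ℕ) : Integrable (vn n) μ := by
  have := FiniteDimensional.proper ℝ V
  obtain ⟨R, hR⟩ := hv.bound
  have hm := (hv.measurable_seq n).aestronglyMeasurable (μ := μ)
  refine ⟨hm, ?_⟩
  have h := setLIntegral_enorm_le hθ hm univ
  rw [setLIntegral_univ] at h
  refine lt_of_le_of_lt h ?_
  have h0 : 0 ≤ 1 / θ := by positivity
  have h1 : 0 ≤ 1 - 1 / θ := by
    rw [sub_nonneg, div_le_one (by linarith)]
    exact hθ.le
  refine ENNReal.mul_lt_top (ENNReal.rpow_lt_top_of_nonneg h0 ?_)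
    (ENNReal.rpow_lt_top_of_nonneg h1 (measure_ne_top _ _))
  exact ((hR n).trans_lt ENNReal.coe_lt_top).ne

omit [MetrizableSpace X] [SecondCountableTopology X] in
/-- Lower semicontinuity for one affine piece of the integrand. -/
lemma lintegral_affine_le_liminf [IsFiniteMeasure μ] (hθ : 1 < θ)
    {xn : ℕ → T → X} {x : T → X} (hxn : ∀ n, Measurable (xn n)) (hx : Measurable x)
    (hlim : ∀ t, Tendsto (fun n => xn n t) atTop (𝓝 (x t)))
    {vn : ℕ → T → V} {v : T → V} (hv : VelocityTendsto μ θ vn v)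
    {l : V →L[ℝ] ℝ} {c : ℝ} {B : Set X} (hB : IsOpen B) {A : Set T} (hA : MeasurableSet A)
    (hAB : ∀ᵐ t ∂μ, t ∈ A → ∀ x ∈ B, ∀ p, l p + c ≤ f t x p) {D : Set T} (hD : MeasurableSet D) :
    ∫⁻ t in D, (A ∩ x ⁻¹' B).indicator (fun t => ENNReal.ofReal (l (v t) + c)) t ∂μ ≤
      liminf (fun n => ∫⁻ t in D, (f t (xn n t) (vn n t) : ℝ≥0∞) ∂μ) atTop := by
  have := FiniteDimensional.proper ℝ V
  have hlv : Measurable fun t => l (v t) := l.measurable.comp hv.measurable_lim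
  set S := (A ∩ x ⁻¹' B) ∩ {t | 0 ≤ l (v t) + c} with hS
  have hSm : MeasurableSet S :=
    (hA.inter (hx hB.measurableSet)).inter (measurableSet_le measurable_const (hlv.add_const c))
  set D' := S ∩ D with hD'
  have hD'm : MeasurableSet D' := hSm.inter hD
  have hintv : Integrable (fun t => l (v t) + c) (μ.restrict D') :=
    ((hv.integrable_lim l).add (integrable_const c)).restrict
  have hintvn : ∀ n, Integrable (fun t => l (vn n t)) μ := fun n =>
    l.integrable_comp (hv.integrable_seq hθ n)
  have hintvn' : ∀ n, Integrable (fun t => l (vn n t) + c) (μ.restrict D') := fun n =>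
    ((hintvn n).add (integrable_const c)).restrict
  have hleft : ∫⁻ t in D, (A ∩ x ⁻¹' B).indicator (fun t => ENNReal.ofReal (l (v t) + c)) t ∂μ =
      ENNReal.ofReal (∫ t in D', (l (v t) + c) ∂μ) := by
    rw [ofReal_integral_eq_lintegral_ofReal hintv, hD', ← setLIntegral_indicator hSm]
    · refine lintegral_congr fun t => ?_
      by_cases h1 : t ∈ A ∩ x ⁻¹' B
      · by_cases h2 : 0 ≤ l (v t) + c
        · rw [indicator_of_mem h1, indicator_of_mem (show t ∈ S from ⟨h1, h2⟩)]
        · rw [indicator_of_mem h1, indicator_of_notMem (fun h : t ∈ S => h2 h.2),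
            ENNReal.ofReal_of_nonpos (not_le.1 h2).le]
      · rw [indicator_of_notMem h1, indicator_of_notMem (fun h : t ∈ S => h1 h.1)]
    · filter_upwards [ae_restrict_mem hD'm] with t ht
      exact ht.1.2
  let E : ℕ → Set T := fun n => x ⁻¹' B \ xn n ⁻¹' B
  have hEm : ∀ n, MeasurableSet (E n) := fun n =>
    (hx hB.measurableSet).diff (hxn n hB.measurableSet)
  have hE0 : Tendsto (fun n => μ (E n)) atTop (𝓝 0) := by
    have := tendsto_measure_of_tendsto_indicator (μ := μ) (A := ∅) (As := E) atTop hEm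
      MeasurableSet.univ (measure_ne_top _ _) (Eventually.of_forall fun n => subset_univ _) (by
        intro t
        by_cases ht : x t ∈ B
        · filter_upwards [(hlim t).eventually (hB.mem_nhds ht)] with n hn
          have hn' : xn n t ∈ B := hn
          simp [E, hn']
        · exact Eventually.of_forall fun n => by simp [E, ht])
    simpa using this
  let ε : ℕ → ℝ≥0∞ := fun n => ∫⁻ t in E n, ENNReal.ofReal (l (vn n t) + c) ∂μ
  -- the times at which `xₙ` has left `B` contribute little, by equi-integrability
  have hε : Tendsto ε atTop (𝓝 0) := by
    obtain ⟨R, hR⟩ := hv.bound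
    have hbound : ∀ n, ε n ≤ ‖l‖ₑ * ((R : ℝ≥0∞) ^ (1 / θ) * μ (E n) ^ (1 - 1 / θ)) +
        ‖c‖ₑ * μ (E n) := by
      intro n
      calc ε n ≤ ∫⁻ t in E n, (‖l‖ₑ * ‖vn n t‖ₑ + ‖c‖ₑ) ∂μ := by
            refine lintegral_mono fun t => ?_
            calc ENNReal.ofReal (l (vn n t) + c) ≤ ‖l (vn n t) + c‖ₑ := by
                  rw [← ofReal_norm]
                  exact ENNReal.ofReal_le_ofReal (Real.le_norm_self _)
              _ ≤ ‖l (vn n t)‖ₑ + ‖c‖ₑ := enorm_add_le _ _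
              _ ≤ _ := by
                gcongr
                exact l.le_opENorm _
        _ = ‖l‖ₑ * ∫⁻ t in E n, ‖vn n t‖ₑ ∂μ + ‖c‖ₑ * μ (E n) := by
            rw [lintegral_add_right _ measurable_const,
              lintegral_const_mul _ (hv.measurable_seq n).enorm, setLIntegral_const]
        _ ≤ _ := by
            gcongr
            refine (setLIntegral_enorm_le hθ
              (hv.measurable_seq n).aestronglyMeasurable (E n)).trans ?_
            gcongr
            exact hR n
    have h1 : 0 < 1 - 1 / θ := by
      rw [sub_pos, div_lt_one (by linarith)]
      exact hθ
    have h2 : Tendsto (fun n => μ (E n) ^ (1 - 1 / θ)) atTop (𝓝 0) := by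
      have := (ENNReal.continuous_rpow_const (y := 1 - 1 / θ)).tendsto 0
      rw [ENNReal.zero_rpow_of_pos h1] at this
      exact this.comp hE0
    have hRne : (R : ℝ≥0∞) ^ (1 / θ) ≠ ⊤ :=
      ENNReal.rpow_ne_top_of_nonneg (by positivity) ENNReal.coe_ne_top
    have h3 := ENNReal.Tendsto.const_mul (a := (R : ℝ≥0∞) ^ (1 / θ)) h2 (Or.inr hRne)
    have h4 := ENNReal.Tendsto.const_mul (a := ‖l‖ₑ) h3 (Or.inr enorm_ne_top)
    have h5 := ENNReal.Tendsto.const_mul (a := ‖c‖ₑ) hE0 (Or.inr enorm_ne_top)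
    refine tendsto_of_tendsto_of_tendsto_of_le_of_le tendsto_const_nhds ?_ (fun n => zero_le)
      hbound
    simpa using h4.add h5
  have hn : ∀ n, ENNReal.ofReal (∫ t in D', (l (vn n t) + c) ∂μ) ≤
      ∫⁻ t in D, (f t (xn n t) (vn n t) : ℝ≥0∞) ∂μ + ε n := by
    intro n
    refine (ofReal_integral_le_lintegral (hintvn' n)).trans ?_
    rw [← lintegral_inter_add_sdiff _ D' (hxn n hB.measurableSet)]
    refine add_le_add ?_ (lintegral_mono_set ?_)
    · calc ∫⁻ t in D' ∩ xn n ⁻¹' B, ENNReal.ofReal (l (vn n t) + c) ∂μ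
          ≤ ∫⁻ t in D' ∩ xn n ⁻¹' B, (f t (xn n t) (vn n t) : ℝ≥0∞) ∂μ := by
            refine setLIntegral_mono_ae' (hD'm.inter (hxn n hB.measurableSet)) ?_
            filter_upwards [hAB] with t ht htD
            rw [← ENNReal.ofReal_coe_nnreal]
            exact ENNReal.ofReal_le_ofReal (ht htD.1.1.1.1 _ htD.2 _)
        _ ≤ _ := lintegral_mono_set fun t ht => ht.1.2
    · exact fun t ht => ⟨ht.1.1.1.2, ht.2⟩
  have htend : Tendsto (fun n => ENNReal.ofReal (∫ t in D', (l (vn n t) + c) ∂μ)) atTop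
      (𝓝 (ENNReal.ofReal (∫ t in D', (l (v t) + c) ∂μ))) := by
    refine ENNReal.tendsto_ofReal ?_
    have h1 := (hv.tendsto D' hD'm l).add_const (∫ _t in D', c ∂μ)
    rw [← integral_add (hv.integrable_lim l).restrict (integrable_const c)] at h1
    refine h1.congr fun n => ?_
    rw [← integral_add (hintvn n).restrict (integrable_const c)]
  rw [hleft, ← htend.liminf_eq, ← ENNReal.liminf_add_of_right_tendsto_zero hε
    (fun n => ∫⁻ t in D, (f t (xn n t) (vn n t) : ℝ≥0∞) ∂μ)]
  exact liminf_le_liminf (Eventually.of_forall hn)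

omit [MetrizableSpace X] in
/-- **Lower semicontinuity** of integral functionals with convex superlinear integrand, along
pointwise convergent states and weakly convergent velocities. -/
theorem lintegral_le_liminf_of_convex [IsFiniteMeasure μ] (hf : IsConvexIntegrand μ f α θ)
    {xn : ℕ → T → X} {x : T → X} (hxn : ∀ n, Measurable (xn n)) (hx : Measurable x)
    (hlim : ∀ t, Tendsto (fun n => xn n t) atTop (𝓝 (x t)))
    {vn : ℕ → T → V} {v : T → V} (hv : VelocityTendsto μ θ vn v) :
    ∫⁻ t, (f t (x t) (v t) : ℝ≥0∞) ∂μ ≤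
      liminf (fun n => ∫⁻ t, (f t (xn n t) (vn n t) : ℝ≥0∞) ∂μ) atTop := by
  obtain ⟨l, c, B, A, hB, hA, hle, hsup⟩ := hf.exists_affine_family
  let g : ℕ → T → ℝ≥0∞ := fun j =>
    (A j ∩ x ⁻¹' B j).indicator fun t => ENNReal.ofReal (l j (v t) + c j)
  have hgm : ∀ j, Measurable (g j) := fun j =>
    (((l j).measurable.comp hv.measurable_lim).add_const _).ennreal_ofReal.indicator
      ((hA j).inter (hx (hB j).measurableSet))
  have hpiece : ∀ j D, MeasurableSet D → ∫⁻ t in D, g j t ∂μ ≤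
      liminf (fun n => ∫⁻ t in D, (f t (xn n t) (vn n t) : ℝ≥0∞) ∂μ) atTop := fun j D hD =>
    lintegral_affine_le_liminf hf.one_lt hxn hx hlim hv (hB j) (hA j)
      (by filter_upwards [hle] with t ht using ht j) hD
  have hpm : ∀ J, Measurable (partialSups g J) := by
    intro J
    induction J with
    | zero => rw [partialSups_zero]; exact hgm 0
    | succ J ih => rw [partialSups_add_one]; exact ih.sup (hgm _)
  -- finite suprema: split the domain according to which function is larger
  have hfin : ∀ J D, MeasurableSet D → ∫⁻ t in D, partialSups g J t ∂μ ≤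
      liminf (fun n => ∫⁻ t in D, (f t (xn n t) (vn n t) : ℝ≥0∞) ∂μ) atTop := by
    intro J
    induction J with
    | zero =>
      intro D hD
      rw [partialSups_zero]
      exact hpiece 0 D hD
    | succ J ih =>
      intro D hD
      set P := {t | partialSups g J t ≤ g (J + 1) t} with hP
      have hPm : MeasurableSet P := measurableSet_le (hpm J) (hgm _)
      rw [← lintegral_inter_add_sdiff _ D hPm]
      have h1 : ∫⁻ t in D ∩ P, partialSups g (J + 1) t ∂μ = ∫⁻ t in D ∩ P, g (J + 1) t ∂μ := by
        refine setLIntegral_congr_fun (hD.inter hPm) fun t ht => ?_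
        rw [partialSups_add_one]
        exact sup_eq_right.2 ht.2
      have h2 : ∫⁻ t in D \ P, partialSups g (J + 1) t ∂μ =
          ∫⁻ t in D \ P, partialSups g J t ∂μ := by
        refine setLIntegral_congr_fun (hD.diff hPm) fun t ht => ?_
        rw [partialSups_add_one]
        exact sup_eq_left.2 (not_le.1 ht.2).le
      rw [h1, h2]
      refine (add_le_add (hpiece _ _ (hD.inter hPm)) (ih _ (hD.diff hPm))).trans ?_
      refine (add_liminf_le _ _).trans_eq ?_
      simp only [lintegral_inter_add_sdiff _ D hPm]
  calc ∫⁻ t, (f t (x t) (v t) : ℝ≥0∞) ∂μ ≤ ∫⁻ t, ⨆ J, partialSups g J t ∂μ := by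
        refine lintegral_mono_ae ?_
        filter_upwards [hsup] with t ht
        refine le_of_forall_lt fun a ha => ?_
        obtain ⟨r, hr1, hr2⟩ := exists_between ha
        have hrtop : r ≠ ⊤ := (hr2.trans ENNReal.coe_lt_top).ne
        have hr3 : r.toReal < f t (x t) (v t) := by
          have := (ENNReal.toReal_lt_toReal hrtop ENNReal.coe_ne_top).2 hr2
          simpa using this
        obtain ⟨j, hj1, hj2, hj3⟩ := ht _ _ _ hr3
        refine hr1.trans_le (le_iSup_of_le j ?_)
        have : g j t ≤ partialSups g j t := le_partialSups g j t
        refine le_trans ?_ this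
        simp only [g]
        rw [indicator_of_mem (show t ∈ A j ∩ x ⁻¹' B j from ⟨hj1, hj2⟩),
          ← ENNReal.ofReal_toReal hrtop]
        exact ENNReal.ofReal_le_ofReal hj3.le
    _ = ⨆ J, ∫⁻ t, partialSups g J t ∂μ :=
        lintegral_iSup hpm fun i j hij => (partialSups g).monotone hij
    _ ≤ _ := iSup_le fun J => by simpa using hfin J univ MeasurableSet.univ

end

/-! ### Convergence of integrals from a generating family of sets -/

/-- Convergence of integrals on a generating π-system and equi-integrability give convergence on all
measurable sets. -/
lemma tendsto_setIntegral_of_isPiSystem {T : Type*} [mT : MeasurableSpace T] {μ : Measure T}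
    [IsFiniteMeasure μ] {gn : ℕ → T → ℝ} {g : T → ℝ} (hgn : ∀ n, Integrable (gn n) μ)
    (hg : Integrable g μ) {ω : ℝ≥0∞ → ℝ≥0∞} (hω : Tendsto ω (𝓝 0) (𝓝 0))
    (hbound : ∀ n E, ‖∫ t in E, gn n t ∂μ‖ₑ ≤ ω (μ E)) {P : Set (Set T)}
    (hgen : mT = MeasurableSpace.generateFrom P) (hP : IsPiSystem P)
    (huniv : Tendsto (fun n => ∫ t, gn n t ∂μ) atTop (𝓝 (∫ t, g t ∂μ)))
    (hlim : ∀ D ∈ P, Tendsto (fun n => ∫ t in D, gn n t ∂μ) atTop (𝓝 (∫ t in D, g t ∂μ)))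
    {D : Set T} (hD : MeasurableSet D) :
    Tendsto (fun n => ∫ t in D, gn n t ∂μ) atTop (𝓝 (∫ t in D, g t ∂μ)) := by
  induction D, hD using MeasurableSpace.induction_on_inter hgen hP with
  | empty => simp
  | basic D hD => exact hlim D hD
  | compl D hD ih =>
    have h1 : ∀ n, ∫ t in Dᶜ, gn n t ∂μ = ∫ t, gn n t ∂μ - ∫ t in D, gn n t ∂μ := fun n => by
      rw [← integral_add_compl hD (hgn n)]; ring
    have h2 : ∫ t in Dᶜ, g t ∂μ = ∫ t, g t ∂μ - ∫ t in D, g t ∂μ := by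
      rw [← integral_add_compl hD hg]; ring
    simp only [h1, h2]
    exact huniv.sub ih
  | iUnion D hdisj hDm ih =>
    let S : ℕ → Set T := fun N => ⋃ i ∈ Finset.range N, D i
    have hSm : ∀ N, MeasurableSet (S N) := fun N =>
      Finset.measurableSet_biUnion _ fun i _ => hDm i
    have hSmono : Monotone S := fun M N hMN =>
      biUnion_subset_biUnion_left fun i hi =>
        Finset.mem_range.2 ((Finset.mem_range.1 hi).trans_le hMN)
    have hSsub : ∀ N, S N ⊆ ⋃ i, D i := fun N => iUnion₂_subset fun i _ => subset_iUnion D i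
    have hSU : ⋃ N, S N = ⋃ i, D i := by
      refine subset_antisymm (iUnion_subset hSsub) (iUnion_subset fun i => ?_)
      exact subset_iUnion_of_subset (i + 1)
        (subset_biUnion_of_mem (u := D) (Finset.mem_coe.2 (Finset.self_mem_range_succ i)))
    have hUm : MeasurableSet (⋃ i, D i) := MeasurableSet.iUnion hDm
    have hrest : Tendsto (fun N => μ ((⋃ i, D i) \ S N)) atTop (𝓝 0) := by
      have h1 := tendsto_measure_iInter_atTop (μ := μ) (s := fun N => (⋃ i, D i) \ S N)
        (fun N => (hUm.diff (hSm N)).nullMeasurableSet)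
        (fun M N hMN => sdiff_subset_sdiff_right (hSmono hMN)) ⟨0, measure_ne_top _ _⟩
      rw [← sdiff_iUnion, hSU, sdiff_self] at h1
      simpa [Function.comp_def] using h1
    -- interchange the limits `N → ∞` and `n → ∞`, the former being uniform in `n`
    refine TendstoUniformly.tendsto_of_eventually_tendsto (p := atTop)
      (F := fun N n => ∫ t in S N, gn n t ∂μ) (L := fun N => ∫ t in S N, g t ∂μ) ?_ ?_ ?_
    · rw [Metric.tendstoUniformly_iff]
      intro ε hε
      have h1 := hω.comp hrest
      filter_upwards [h1.eventually (gt_mem_nhds (ENNReal.ofReal_pos.2 hε))] with N hN n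
      have h2 : ∫ t in ⋃ i, D i, gn n t ∂μ - ∫ t in S N, gn n t ∂μ =
          ∫ t in (⋃ i, D i) \ S N, gn n t ∂μ :=
        (setIntegral_sdiff (hSm N) (hgn n).integrableOn (hSsub N)).symm
      rw [dist_eq_norm, h2]
      have h3 := (hbound n ((⋃ i, D i) \ S N)).trans_lt hN
      rw [← ofReal_norm] at h3
      exact (ENNReal.ofReal_lt_ofReal_iff hε).1 h3
    · refine Eventually.of_forall fun N => ?_
      have hfin : ∀ f : T → ℝ, Integrable f μ →
          ∫ t in S N, f t ∂μ = ∑ i ∈ Finset.range N, ∫ t in D i, f t ∂μ := fun f hf =>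
        integral_biUnion_finset _ (fun i _ => hDm i) (fun i _ j _ hij => hdisj hij)
          fun i _ => hf.integrableOn
      simp only [hfin _ (hgn _), hfin _ hg]
      exact tendsto_finsetSum _ fun i _ => ih i
    · have := tendsto_setIntegral_of_monotone (μ := μ) hSm hSmono (f := g) hg.integrableOn
      rwa [hSU] at this

/-! ### Lebesgue measure on the half-line -/

lemma measurableEmbedding_coe_nnreal : MeasurableEmbedding ((↑) : ℝ≥0 → ℝ) :=
  MeasurableEmbedding.subtype_coe (measurableSet_Ici (a := (0 : ℝ)))

lemma map_coe_lebesgueHalfLine :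
    lebesgueHalfLine.map ((↑) : ℝ≥0 → ℝ) = volume.restrict (Ici 0) := by
  have h : range ((↑) : ℝ≥0 → ℝ) = Ici 0 := by
    ext x
    exact ⟨fun ⟨r, hr⟩ => hr ▸ r.coe_nonneg, fun hx => ⟨⟨x, hx⟩, rfl⟩⟩
  rw [lebesgueHalfLine, measurableEmbedding_coe_nnreal.map_comap, h]

lemma setLIntegral_lebesgueHalfLine (g : ℝ → ℝ≥0∞) (S : Set ℝ) (hS : MeasurableSet S) :
    ∫⁻ t in ((↑) : ℝ≥0 → ℝ) ⁻¹' S, g t ∂lebesgueHalfLine = ∫⁻ s in S ∩ Ici 0, g s := by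
  rw [← Measure.restrict_restrict hS, ← map_coe_lebesgueHalfLine,
    measurableEmbedding_coe_nnreal.restrict_map, measurableEmbedding_coe_nnreal.lintegral_map]

lemma lintegral_lebesgueHalfLine (g : ℝ → ℝ≥0∞) :
    ∫⁻ t, g (t : ℝ) ∂lebesgueHalfLine = ∫⁻ s in Ici (0 : ℝ), g s := by
  have := setLIntegral_lebesgueHalfLine g univ MeasurableSet.univ
  simpa using this

lemma lebesgueHalfLine_Iic (r : ℝ≥0) : lebesgueHalfLine (Iic r) = r := by
  have h := setLIntegral_lebesgueHalfLine (fun _ => 1) (Iic (r : ℝ)) measurableSet_Iic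
  have h1 : ((↑) : ℝ≥0 → ℝ) ⁻¹' Iic (r : ℝ) = Iic r := by ext; simp
  rw [h1, setLIntegral_one, setLIntegral_one, inter_comm, Ici_inter_Iic, Real.volume_Icc,
    sub_zero, ENNReal.ofReal_coe_nnreal] at h
  exact h

lemma setIntegral_Iic_lebesgueHalfLine (g : ℝ → ℝ) (r : ℝ≥0) :
    ∫ t in Iic r, g (t : ℝ) ∂lebesgueHalfLine = ∫ s in (0 : ℝ)..r, g s := by
  have h1 : ((↑) : ℝ≥0 → ℝ) ⁻¹' Iic (r : ℝ) = Iic r := by ext; simp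
  rw [← h1, ← measurableEmbedding_coe_nnreal.setIntegral_map, map_coe_lebesgueHalfLine,
    Measure.restrict_restrict measurableSet_Iic, inter_comm, Ici_inter_Iic,
    integral_Icc_eq_integral_Ioc, intervalIntegral.integral_of_le r.coe_nonneg]

lemma integrableOn_Iic_lebesgueHalfLine {g : ℝ → ℝ} {r : ℝ≥0}
    (hg : IntervalIntegrable g volume 0 r) :
    IntegrableOn (fun t : ℝ≥0 => g t) (Iic r) lebesgueHalfLine := by
  have h1 : ((↑) : ℝ≥0 → ℝ) ⁻¹' Iic (r : ℝ) = Iic r := by ext; simp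
  have h2 : IntegrableOn g (Iic (r : ℝ)) (lebesgueHalfLine.map ((↑) : ℝ≥0 → ℝ)) := by
    rw [IntegrableOn, map_coe_lebesgueHalfLine, Measure.restrict_restrict measurableSet_Iic,
      inter_comm, Ici_inter_Iic, ← IntegrableOn, integrableOn_Icc_iff_integrableOn_Ioc]
    exact (intervalIntegrable_iff_integrableOn_Ioc_of_le r.coe_nonneg).1 hg
  rw [measurableEmbedding_coe_nnreal.integrableOn_map_iff, h1] at h2
  exact h2

instance (r : ℝ≥0) : IsFiniteMeasure (lebesgueHalfLine.restrict (Iic r)) :=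
  ⟨by rw [Measure.restrict_apply_univ, lebesgueHalfLine_Iic]; exact ENNReal.coe_lt_top⟩

lemma lebesgueHalfLine_lt_le (σ : ℝ≥0∞) :
    lebesgueHalfLine {t : ℝ≥0 | (t : ℝ≥0∞) < σ} ≤ σ := by
  by_cases hσ : σ = ⊤
  · simp [hσ]
  · lift σ to ℝ≥0 using hσ
    calc lebesgueHalfLine {t : ℝ≥0 | (t : ℝ≥0∞) < σ} ≤ lebesgueHalfLine (Iic σ) :=
          measure_mono fun t ht => (ENNReal.coe_lt_coe.1 ht).le
      _ = σ := lebesgueHalfLine_Iic σ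

/-! ### Absolutely continuous curves -/

section curves

variable {d : ℕ} {Ω : Set (EuclideanSpace ℝ (Fin d))}

lemma measurable_velocity (γ : Curve Ω) : Measurable (velocity γ) :=
  (measurable_deriv (realPath γ)).comp measurable_subtype_coe

@[simp]
lemma realPath_coe (γ : Curve Ω) (t : ℝ≥0) : realPath γ t = γ t := by
  simp [realPath]

/-- The `θ`-energy `∫ ‖γ̇‖ ^ θ` of a curve. -/
noncomputable def energy (θ : ℝ) (γ : Curve Ω) : ℝ≥0∞ :=
  ∫⁻ t, ‖velocity γ t‖ₑ ^ θ ∂lebesgueHalfLine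

lemma energy_eq (θ : ℝ) (γ : Curve Ω) :
    energy θ γ = ∫⁻ s in Ici (0 : ℝ), ‖deriv (realPath γ) s‖ₑ ^ θ :=
  lintegral_lebesgueHalfLine fun s => ‖deriv (realPath γ) s‖ₑ ^ θ

namespace IsAbsCont

variable {γ : Curve Ω} (hγ : IsAbsCont γ)
include hγ

lemma on_uIcc {a b : ℝ} (ha : 0 ≤ a) (hb : 0 ≤ b) :
    AbsolutelyContinuousOnInterval (realPath γ) a b := by
  refine (hγ (max a b + 1) (by positivity)).mono ?_
  rw [uIcc_of_le (by positivity : (0 : ℝ) ≤ max a b + 1)]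
  intro x hx
  rw [uIcc, mem_Icc] at hx
  exact ⟨(le_min ha hb).trans hx.1, hx.2.trans (by linarith)⟩

lemma ae_differentiableAt : ∀ᵐ s : ℝ, 0 ≤ s → DifferentiableAt ℝ (realPath γ) s := by
  have h : ∀ᵐ s : ℝ, ∀ n : ℕ, s ∈ uIcc (0 : ℝ) n → DifferentiableAt ℝ (realPath γ) s := by
    rw [ae_all_iff]
    exact fun n =>
      (hγ.on_uIcc le_rfl n.cast_nonneg).boundedVariationOn.ae_differentiableAt_of_mem_uIcc
  filter_upwards [h] with s hs h0
  obtain ⟨n, hn⟩ := exists_nat_ge s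
  exact hs n (by rw [uIcc_of_le n.cast_nonneg]; exact ⟨h0, hn⟩)

lemma clm_comp (l : EuclideanSpace ℝ (Fin d) →L[ℝ] ℝ) {a b : ℝ} (ha : 0 ≤ a) (hb : 0 ≤ b) :
    AbsolutelyContinuousOnInterval (fun s => l (realPath γ s)) a b := by
  have h := hγ.on_uIcc ha hb
  refine squeeze_zero (fun E => by positivity) (fun E => ?_)
    (by simpa using Tendsto.const_mul ‖l‖ h)
  rw [Finset.mul_sum]
  gcongr with i _
  rw [dist_eq_norm, dist_eq_norm, ← map_sub]
  exact l.le_opNorm _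

lemma ae_deriv_clm (l : EuclideanSpace ℝ (Fin d) →L[ℝ] ℝ) :
    ∀ᵐ s : ℝ, 0 ≤ s → deriv (fun s => l (realPath γ s)) s = l (deriv (realPath γ) s) := by
  filter_upwards [hγ.ae_differentiableAt] with s hs h0
  exact (l.hasFDerivAt.comp_hasDerivAt s (hs h0).hasDerivAt).deriv

lemma ae_deriv_clm_uIoc (l : EuclideanSpace ℝ (Fin d) →L[ℝ] ℝ) {a b : ℝ} (ha : 0 ≤ a)
    (hb : 0 ≤ b) :
    ∀ᵐ s : ℝ, s ∈ uIoc a b → deriv (fun s => l (realPath γ s)) s = l (deriv (realPath γ) s) := by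
  filter_upwards [hγ.ae_deriv_clm l] with s hs h
  exact hs ((le_min ha hb).trans h.1.le)

lemma intervalIntegrable_clm (l : EuclideanSpace ℝ (Fin d) →L[ℝ] ℝ) {a b : ℝ} (ha : 0 ≤ a)
    (hb : 0 ≤ b) : IntervalIntegrable (fun s => l (deriv (realPath γ) s)) volume a b :=
  (hγ.clm_comp l ha hb).intervalIntegrable_deriv.congr_ae
    ((ae_restrict_iff' measurableSet_uIoc).2 (hγ.ae_deriv_clm_uIoc l ha hb))

/-- The fundamental theorem of calculus, coordinate by coordinate. -/
lemma integral_clm (l : EuclideanSpace ℝ (Fin d) →L[ℝ] ℝ) {a b : ℝ} (ha : 0 ≤ a) (hb : 0 ≤ b) :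
    ∫ s in a..b, l (deriv (realPath γ) s) = l (realPath γ b) - l (realPath γ a) := by
  rw [← (hγ.clm_comp l ha hb).integral_deriv_eq_sub]
  exact intervalIntegral.integral_congr_ae
    ((hγ.ae_deriv_clm_uIoc l ha hb).mono fun s hs h => (hs h).symm)

/-- The distance of two points of a curve is at most the length of the arc between them; this
follows from the scalar fundamental theorem by testing with a norming functional. -/
lemma edist_le_setLIntegral {a b : ℝ} (ha : 0 ≤ a) (hb : 0 ≤ b) :
    edist (realPath γ a) (realPath γ b) ≤ ∫⁻ s in uIoc a b, ‖deriv (realPath γ) s‖ₑ := by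
  obtain ⟨l, hl, hle⟩ := exists_dual_vector'' ℝ (realPath γ b - realPath γ a)
  have h1 := hγ.integral_clm l ha hb
  rw [← map_sub, hle] at h1
  rw [edist_comm, edist_eq_enorm_sub, ← enorm_norm]
  have h2 : ‖‖realPath γ b - realPath γ a‖‖ₑ = ‖∫ s in a..b, l (deriv (realPath γ) s)‖ₑ := by
    rw [h1]; rfl
  rw [h2]
  have h3 : ‖∫ s in a..b, l (deriv (realPath γ) s)‖ₑ =
      ‖∫ s in uIoc a b, l (deriv (realPath γ) s)‖ₑ := by
    rw [← ofReal_norm, ← ofReal_norm, intervalIntegral.norm_intervalIntegral_eq]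
  rw [h3]
  refine (enorm_integral_le_lintegral_enorm _).trans (lintegral_mono fun s => ?_)
  refine (l.le_opENorm _).trans ?_
  have : ‖l‖ₑ ≤ 1 := by
    rw [← ofReal_norm, ← ENNReal.ofReal_one]
    exact ENNReal.ofReal_le_ofReal hl
  calc ‖l‖ₑ * _ ≤ 1 * _ := by gcongr
    _ = _ := one_mul _

lemma integrableOn_clm_velocity (l : EuclideanSpace ℝ (Fin d) →L[ℝ] ℝ) (r : ℝ≥0) :
    IntegrableOn (fun t => l (velocity γ t)) (Iic r) lebesgueHalfLine :=
  integrableOn_Iic_lebesgueHalfLine (g := fun s => l (deriv (realPath γ) s))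
    (hγ.intervalIntegrable_clm l le_rfl r.coe_nonneg)

lemma setIntegral_clm_velocity (l : EuclideanSpace ℝ (Fin d) →L[ℝ] ℝ) (r : ℝ≥0) :
    ∫ t in Iic r, l (velocity γ t) ∂lebesgueHalfLine = l (γ r) - l (γ 0) := by
  have h := setIntegral_Iic_lebesgueHalfLine (fun s => l (deriv (realPath γ) s)) r
  rw [hγ.integral_clm l le_rfl r.coe_nonneg] at h
  have h0 : realPath γ 0 = γ 0 := by simpa using realPath_coe γ 0
  rw [realPath_coe, h0] at h
  exact h

end IsAbsCont

/-- The modulus of continuity forced by a bound `R` on the `θ`-energy. -/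
noncomputable def holderModulus (θ : ℝ) (R : ℝ≥0) (u : ℝ≥0∞) : ℝ≥0∞ :=
  (R : ℝ≥0∞) ^ (1 / θ) * u ^ (1 - 1 / θ)

lemma tendsto_holderModulus {θ : ℝ} (hθ : 1 < θ) (R : ℝ≥0) :
    Tendsto (holderModulus θ R) (𝓝 0) (𝓝 0) := by
  have h1 : 0 < 1 - 1 / θ := by
    rw [sub_pos, div_lt_one (by linarith)]
    exact hθ
  have h2 := (ENNReal.continuous_rpow_const (y := 1 - 1 / θ)).tendsto 0
  rw [ENNReal.zero_rpow_of_pos h1] at h2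
  have hRne : (R : ℝ≥0∞) ^ (1 / θ) ≠ ⊤ :=
    ENNReal.rpow_ne_top_of_nonneg (by positivity) ENNReal.coe_ne_top
  have h3 := ENNReal.Tendsto.const_mul (a := (R : ℝ≥0∞) ^ (1 / θ)) h2 (Or.inr hRne)
  rw [mul_zero] at h3
  exact h3

lemma setLIntegral_deriv_le {θ : ℝ} (hθ : 1 < θ) {R : ℝ≥0} {γ : Curve Ω} (hR : energy θ γ ≤ R)
    {S : Set ℝ} (hS : S ⊆ Ici 0) :
    ∫⁻ s in S, ‖deriv (realPath γ) s‖ₑ ≤ holderModulus θ R (volume S) := by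
  have h := setLIntegral_enorm_le (μ := volume.restrict (Ici (0 : ℝ))) hθ
    (measurable_deriv (realPath γ)).aestronglyMeasurable S
  rw [Measure.restrict_restrict_of_subset hS, Measure.restrict_eq_self _ hS, ← energy_eq] at h
  refine h.trans ?_
  unfold holderModulus
  gcongr

/-- A pointwise limit of absolutely continuous curves of bounded `θ`-energy is absolutely
continuous. -/
lemma isAbsCont_of_tendsto {θ : ℝ} (hθ : 1 < θ) {R : ℝ≥0} {u : ℕ → Curve Ω} {γ : Curve Ω}
    (hac : ∀ n, IsAbsCont (u n)) (hR : ∀ n, energy θ (u n) ≤ R)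
    (hlim : ∀ t, Tendsto (fun n => u n t) atTop (𝓝 (γ t))) : IsAbsCont γ := by
  intro T hT
  rw [absolutelyContinuousOnInterval_iff]
  intro ε hε
  have h1 := (tendsto_holderModulus hθ R).eventually
    (ge_mem_nhds (ENNReal.ofReal_pos.2 (half_pos hε)))
  obtain ⟨δ, hδ, hδ'⟩ := ENNReal.nhds_zero_basis.eventually_iff.1 h1
  obtain ⟨δ₀, hδ₀, hδ₀'⟩ : ∃ δ₀ : ℝ, 0 < δ₀ ∧ ENNReal.ofReal δ₀ ≤ δ := by
    by_cases h : δ = ⊤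
    · exact ⟨1, one_pos, by simp [h]⟩
    · exact ⟨δ.toReal, ENNReal.toReal_pos hδ.ne' h, (ENNReal.ofReal_toReal h).le⟩
  refine ⟨δ₀, hδ₀, fun E hE hlen => ?_⟩
  have hmem : ∀ i ∈ Finset.range E.1, 0 ≤ (E.2 i).1 ∧ 0 ≤ (E.2 i).2 := by
    intro i hi
    have := hE.1 i hi
    rw [uIcc_of_le hT.le] at this
    exact ⟨this.1.1, this.2.1⟩
  have hn : ∀ n, ∑ i ∈ Finset.range E.1,
      dist (realPath (u n) (E.2 i).1) (realPath (u n) (E.2 i).2) ≤ ε / 2 := by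
    intro n
    rw [← ENNReal.ofReal_le_ofReal_iff (by positivity),
      ENNReal.ofReal_sum_of_nonneg fun i _ => dist_nonneg]
    simp only [← edist_dist]
    have hsub : (⋃ i ∈ Finset.range E.1, uIoc (E.2 i).1 (E.2 i).2) ⊆ Ici 0 := by
      refine iUnion₂_subset fun i hi s hs => ?_
      exact (le_min (hmem i hi).1 (hmem i hi).2).trans hs.1.le
    calc ∑ i ∈ Finset.range E.1, edist (realPath (u n) (E.2 i).1) (realPath (u n) (E.2 i).2)
        ≤ ∑ i ∈ Finset.range E.1, ∫⁻ s in uIoc (E.2 i).1 (E.2 i).2,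
            ‖deriv (realPath (u n)) s‖ₑ :=
          Finset.sum_le_sum fun i hi =>
            (hac n).edist_le_setLIntegral (hmem i hi).1 (hmem i hi).2
      _ = ∫⁻ s in ⋃ i ∈ Finset.range E.1, uIoc (E.2 i).1 (E.2 i).2,
            ‖deriv (realPath (u n)) s‖ₑ :=
          (lintegral_biUnion_finset hE.2 (fun i _ => measurableSet_uIoc) _).symm
      _ ≤ holderModulus θ R (volume (⋃ i ∈ Finset.range E.1, uIoc (E.2 i).1 (E.2 i).2)) :=
          setLIntegral_deriv_le hθ (hR n) hsub
      _ ≤ ENNReal.ofReal (ε / 2) := by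
          refine hδ' ?_
          show _ < δ
          refine lt_of_lt_of_le ?_ hδ₀'
          refine (measure_biUnion_finset_le _ _).trans_lt ?_
          have : ∀ i, volume (uIoc (E.2 i).1 (E.2 i).2) =
              ENNReal.ofReal (dist (E.2 i).1 (E.2 i).2) := by
            intro i
            rw [Real.volume_uIoc, dist_comm, Real.dist_eq]
          simp only [this]
          rw [← ENNReal.ofReal_sum_of_nonneg fun i _ => dist_nonneg]
          exact (ENNReal.ofReal_lt_ofReal_iff hδ₀).2 hlen
  have hlim' : ∀ s, Tendsto (fun n => realPath (u n) s) atTop (𝓝 (realPath γ s)) := fun s =>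
    (continuous_subtype_val.tendsto _).comp (hlim s.toNNReal)
  have htend := tendsto_finsetSum (Finset.range E.1) fun i _ =>
    (hlim' (E.2 i).1).dist (hlim' (E.2 i).2)
  have := le_of_tendsto htend (Eventually.of_forall hn)
  linarith

/-- Curves of bounded energy converging pointwise have weakly convergent velocities on bounded time
intervals. -/
lemma velocityTendsto_of_tendsto {θ : ℝ} (hθ : 1 < θ) {R : ℝ≥0} {u : ℕ → Curve Ω} {γ : Curve Ω}
    (hac : ∀ n, IsAbsCont (u n)) (hR : ∀ n, energy θ (u n) ≤ R)
    (hlim : ∀ t, Tendsto (fun n => u n t) atTop (𝓝 (γ t))) (r : ℝ≥0) :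
    VelocityTendsto (lebesgueHalfLine.restrict (Iic r)) θ (fun n => velocity (u n))
      (velocity γ) where
  measurable_seq n := measurable_velocity _
  measurable_lim := measurable_velocity _
  bound := ⟨R, fun n => (setLIntegral_le_lintegral _ _).trans (hR n)⟩
  integrable_lim l := (isAbsCont_of_tendsto hθ hac hR hlim).integrableOn_clm_velocity l r
  tendsto D hD l := by
    have hγ := isAbsCont_of_tendsto hθ hac hR hlim
    have hval : ∀ t, Tendsto (fun n => (l (u n t) : ℝ)) atTop (𝓝 (l (γ t))) := fun t =>
      ((l.continuous.comp continuous_subtype_val).tendsto _).comp (hlim t)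
    have hIic : ∀ s : ℝ≥0, Tendsto
        (fun n => ∫ t in Iic s, l (velocity (u n) t) ∂lebesgueHalfLine) atTop
        (𝓝 (∫ t in Iic s, l (velocity γ t) ∂lebesgueHalfLine)) := by
      intro s
      simp only [(hac _).setIntegral_clm_velocity, hγ.setIntegral_clm_velocity]
      exact (hval s).sub (hval 0)
    have hω : Tendsto (fun x => ‖l‖ₑ * holderModulus θ R x) (𝓝 0) (𝓝 0) := by
      simpa using ENNReal.Tendsto.const_mul (a := ‖l‖ₑ) (tendsto_holderModulus hθ R)
        (Or.inr enorm_ne_top)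
    refine tendsto_setIntegral_of_isPiSystem (P := range Iic)
      (fun n => (hac n).integrableOn_clm_velocity l r) (hγ.integrableOn_clm_velocity l r) hω ?_
      (by rw [← borel_eq_generateFrom_Iic]; exact BorelSpace.measurable_eq) isPiSystem_Iic
      (hIic r) ?_ hD
    · intro n E
      refine (enorm_integral_le_lintegral_enorm _).trans ?_
      calc ∫⁻ t in E, ‖l (velocity (u n) t)‖ₑ ∂lebesgueHalfLine.restrict (Iic r)
          ≤ ∫⁻ t in E, ‖l‖ₑ * ‖velocity (u n) t‖ₑ ∂lebesgueHalfLine.restrict (Iic r) :=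
            lintegral_mono fun t => l.le_opENorm _
        _ = ‖l‖ₑ * ∫⁻ t in E, ‖velocity (u n) t‖ₑ ∂lebesgueHalfLine.restrict (Iic r) :=
            lintegral_const_mul _ (measurable_velocity _).enorm
        _ ≤ _ := by
            gcongr
            refine (setLIntegral_enorm_le hθ
              (measurable_velocity _).aestronglyMeasurable E).trans ?_
            unfold holderModulus
            gcongr
            exact (setLIntegral_le_lintegral _ _).trans (hR n)
    · rintro _ ⟨s, rfl⟩
      simp only [Measure.restrict_restrict measurableSet_Iic, Iic_inter_Iic]
      exact hIic _

/-- A family of maps into a compact space with a common modulus of continuity is compact. -/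
lemma isCompact_setOf_modulus {T X : Type*} [PseudoEMetricSpace T] [EMetricSpace X]
    [CompactSpace X] {ω : ℝ≥0∞ → ℝ≥0∞} (hω : Tendsto ω (𝓝 0) (𝓝 0)) :
    IsCompact {f : C(T, X) | ∀ s t, edist (f s) (f t) ≤ ω (edist s t)} := by
  have hcont : ∀ f : T → X, (∀ s t, edist (f s) (f t) ≤ ω (edist s t)) → Continuous f := by
    intro f hf
    rw [continuous_iff_continuousAt]
    intro s
    rw [ContinuousAt, tendsto_iff_edist_tendsto_0]
    have h1 : Tendsto (fun t => edist t s) (𝓝 s) (𝓝 0) :=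
      tendsto_iff_edist_tendsto_0.1 tendsto_id
    exact tendsto_of_tendsto_of_tendsto_of_le_of_le tendsto_const_nhds (hω.comp h1)
      (fun _ => zero_le) fun t => hf t s
  refine ArzelaAscoli.isCompact_of_equicontinuous _ ?_ ?_
  · have himg : ContinuousMap.toFun '' {f : C(T, X) | ∀ s t, edist (f s) (f t) ≤ ω (edist s t)} =
        {f : T → X | ∀ s t, edist (f s) (f t) ≤ ω (edist s t)} := by
      ext f
      constructor
      · rintro ⟨g, hg, rfl⟩
        exact hg
      · intro hf
        exact ⟨⟨f, hcont f hf⟩, hf, rfl⟩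
    rw [himg]
    have : IsClosed {f : T → X | ∀ s t, edist (f s) (f t) ≤ ω (edist s t)} := by
      simp only [ofPred_forall]
      exact isClosed_iInter fun s => isClosed_iInter fun t =>
        isClosed_le (by fun_prop) continuous_const
    exact this.isCompact
  · intro s
    rw [uniformity_basis_edist.equicontinuousAt_iff_right]
    intro ε hε
    have h1 : Tendsto (fun t => edist s t) (𝓝 s) (𝓝 0) := by
      simp only [edist_comm s]
      exact tendsto_iff_edist_tendsto_0.1 tendsto_id
    filter_upwards [(hω.comp h1).eventually (gt_mem_nhds hε)] with t ht f
    exact (f.2 s t).trans_lt ht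

lemma edist_le_holderModulus {θ : ℝ} (hθ : 1 < θ) {R : ℝ≥0} {γ : Curve Ω} (hγ : IsAbsCont γ)
    (hR : energy θ γ ≤ R) (s t : ℝ≥0) :
    edist (γ s) (γ t) ≤ holderModulus θ R (edist s t) := by
  have h1 := hγ.edist_le_setLIntegral s.2 t.2
  have h2 := setLIntegral_deriv_le hθ hR (S := uIoc (s : ℝ) t)
    fun x hx => (le_min s.2 t.2).trans hx.1.le
  have h3 : volume (uIoc (s : ℝ) t) = edist s t := by
    rw [Real.volume_uIoc, edist_dist, NNReal.dist_eq, abs_sub_comm]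
  rw [h3] at h2
  have h4 : edist (γ s) (γ t) = edist (realPath γ s) (realPath γ t) := by
    rw [realPath_coe, realPath_coe]; rfl
  rw [h4]
  exact h1.trans h2

end curves

/-! ### Pairs of weakly convergent velocities -/

lemma VelocityTendsto.prodMk {T V W : Type*} [MeasurableSpace T] {μ : Measure T}
    [IsFiniteMeasure μ]
    [NormedAddCommGroup V] [NormedSpace ℝ V] [FiniteDimensional ℝ V] [MeasurableSpace V]
    [BorelSpace V] [NormedAddCommGroup W] [NormedSpace ℝ W] [FiniteDimensional ℝ W]
    [MeasurableSpace W] [BorelSpace W] {θ : ℝ} (hθ : 1 < θ) {vn : ℕ → T → V} {v : T → V}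
    {wn : ℕ → T → W} {w : T → W} (hv : VelocityTendsto μ θ vn v)
    (hw : VelocityTendsto μ θ wn w) :
    VelocityTendsto μ θ (fun n t => (vn n t, wn n t)) fun t => (v t, w t) where
  measurable_seq n := (hv.measurable_seq n).prodMk (hw.measurable_seq n)
  measurable_lim := hv.measurable_lim.prodMk hw.measurable_lim
  bound := by
    obtain ⟨R, hR⟩ := hv.bound
    obtain ⟨R', hR'⟩ := hw.bound
    refine ⟨R + R', fun n => ?_⟩
    calc ∫⁻ t, ‖(vn n t, wn n t)‖ₑ ^ θ ∂μ ≤ ∫⁻ t, (‖vn n t‖ₑ ^ θ + ‖wn n t‖ₑ ^ θ) ∂μ := by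
          refine lintegral_mono fun t => ?_
          have h : ‖(vn n t, wn n t)‖ₑ = max ‖vn n t‖ₑ ‖wn n t‖ₑ := by
            simp only [← ofReal_norm, Prod.norm_mk]
            exact ENNReal.ofReal_max _ _
          simp only [h]
          rcases max_cases ‖vn n t‖ₑ ‖wn n t‖ₑ with ⟨h1, -⟩ | ⟨h1, -⟩ <;> rw [h1]
          · exact le_self_add
          · exact le_add_self
      _ = ∫⁻ t, ‖vn n t‖ₑ ^ θ ∂μ + ∫⁻ t, ‖wn n t‖ₑ ^ θ ∂μ :=
          lintegral_add_left ((hv.measurable_seq n).enorm.pow_const θ) _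
      _ ≤ _ := by
          rw [ENNReal.coe_add]
          exact add_le_add (hR n) (hR' n)
  integrable_lim l := by
    have h := (hv.integrable_lim (l.comp (.inl ℝ V W))).add
      (hw.integrable_lim (l.comp (.inr ℝ V W)))
    refine h.congr (Eventually.of_forall fun t => ?_)
    simp [← map_add]
  tendsto D hD l := by
    have hsplit : ∀ p q, l (p, q) = l.comp (.inl ℝ V W) p + l.comp (.inr ℝ V W) q := by
      intro p q
      simp [← map_add]
    simp only [hsplit]
    have h := (hv.tendsto D hD (l.comp (.inl ℝ V W))).add
      (hw.tendsto D hD (l.comp (.inr ℝ V W)))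
    rw [← integral_add (hv.integrable_lim _).restrict (hw.integrable_lim _).restrict] at h
    refine h.congr fun n => (integral_add ?_ ?_).symm
    · exact (ContinuousLinearMap.integrable_comp _ (hv.integrable_seq hθ n)).restrict
    · exact (ContinuousLinearMap.integrable_comp _ (hw.integrable_seq hθ n)).restrict

/-! ### The exit time and its cost -/

section exit

variable {d : ℕ} {Ω : Set (EuclideanSpace ℝ (Fin d))}

lemma lowerSemicontinuous_exitTime {Ξ : Set (EuclideanSpace ℝ (Fin d))} (hΞ : IsClosed Ξ) :
    LowerSemicontinuous (exitTime (Ω := Ω) Ξ) := by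
  rw [lowerSemicontinuous_iff_isOpen_preimage]
  intro c
  by_cases hc : c = ⊤
  · simp [hc]
  lift c to ℝ≥0 using hc
  have hopen : IsOpen (((↑) : closure Ω → EuclideanSpace ℝ (Fin d)) ⁻¹' Ξᶜ) :=
    hΞ.isOpen_compl.preimage continuous_subtype_val
  have hcomp : IsCompact (Iic c) := by
    rw [← Icc_bot]
    exact isCompact_Icc
  convert! ContinuousMap.isOpen_setOfPred_mapsTo hcomp hopen using 1
  ext γ
  constructor
  · intro h t ht hmem
    have : exitTime Ξ γ ≤ t := sInf_le ⟨t, hmem, rfl⟩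
    exact absurd (h.trans_le this) (not_lt.2 (ENNReal.coe_le_coe.2 ht))
  · intro h
    have hc : γ ⁻¹' (((↑) : closure Ω → EuclideanSpace ℝ (Fin d)) ⁻¹' Ξᶜ) ∈ 𝓝 c :=
      (hopen.preimage γ.continuous).mem_nhds (h (mem_Iic.2 le_rfl))
    obtain ⟨s, hs, hsub⟩ := exists_Ico_subset_of_mem_nhds hc ⟨c + 1, by simp⟩
    refine lt_of_lt_of_le (ENNReal.coe_lt_coe.2 hs) (le_sInf ?_)
    rintro _ ⟨t, ht, rfl⟩
    rw [ENNReal.coe_le_coe]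
    by_contra! hlt
    by_cases htc : t ≤ c
    · exact h htc ht
    · exact hsub ⟨(not_le.1 htc).le, hlt⟩ ht

/-- `Ψ` is an admissible exit cost: lower semicontinuous, nondecreasing, and bounded below by
`t ↦ a t - b` with `a, b > 0`. -/
structure IsExitCost (Ψ : ℝ≥0 → ℝ≥0) (a b : ℝ) : Prop where
  lsc : LowerSemicontinuous Ψ
  mono : Monotone Ψ
  pos : 0 < a
  pos' : 0 < b
  lower : ∀ t : ℝ≥0, a * (t : ℝ) - b ≤ (Ψ t : ℝ)

namespace IsExitCost

variable {Ψ : ℝ≥0 → ℝ≥0} {a b : ℝ} (hΨ : IsExitCost Ψ a b)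
include hΨ

lemma monotone_extendTop : Monotone (extendTop Ψ) := by
  intro s t hst
  by_cases ht : t = ⊤
  · simp [extendTop, ht]
  · have hs : s ≠ ⊤ := ne_top_of_le_ne_top ht hst
    simp only [extendTop, hs, ht, if_false, ENNReal.coe_le_coe]
    exact hΨ.mono (ENNReal.toNNReal_mono ht hst)

/-- Linear growth of `Ψ` bounds the exit time by the exit cost. -/
lemma le_extendTop (s : ℝ≥0∞) :
    s ≤ (1 / a).toNNReal * (extendTop Ψ s + b.toNNReal) := by
  have ha : ((1 / a).toNNReal : ℝ≥0∞) ≠ 0 := by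
    rw [ENNReal.coe_ne_zero, ← pos_iff_ne_zero, Real.toNNReal_pos]
    exact one_div_pos.2 hΨ.pos
  by_cases hs : s = ⊤
  · simp only [extendTop, hs, if_true, top_add, ENNReal.mul_top ha, le_refl]
  · lift s to ℝ≥0 using hs
    simp only [extendTop, ENNReal.coe_ne_top, if_false, ENNReal.toNNReal_coe]
    rw [← ENNReal.coe_add, ← ENNReal.coe_mul, ENNReal.coe_le_coe, ← NNReal.coe_le_coe]
    push_cast
    rw [Real.coe_toNNReal _ (one_div_pos.2 hΨ.pos).le, Real.coe_toNNReal _ hΨ.pos'.le,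
      one_div, ← div_eq_inv_mul, le_div_iff₀ hΨ.pos]
    linarith [hΨ.lower s]

lemma lowerSemicontinuous_extendTop : LowerSemicontinuous (extendTop Ψ) := by
  intro s c hc
  by_cases hs : s = ⊤
  · subst hs
    have hcne : c ≠ ⊤ := ne_top_of_lt hc
    have hlim : ∀ᶠ s : ℝ≥0∞ in 𝓝 ⊤, (1 / a).toNNReal * (c + b.toNNReal) < s :=
      lt_mem_nhds (lt_top_iff_ne_top.2 (by finiteness))
    filter_upwards [hlim] with s hs
    by_contra! hle
    refine absurd (hΨ.le_extendTop s) (not_le.2 (lt_of_le_of_lt ?_ hs))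
    gcongr
  · lift s to ℝ≥0 using hs
    rw [ENNReal.nhds_coe, eventually_map]
    simp only [extendTop, ENNReal.coe_ne_top, if_false, ENNReal.toNNReal_coe] at hc ⊢
    have hcne : c ≠ ⊤ := ne_top_of_lt hc
    lift c to ℝ≥0 using hcne
    simp only [ENNReal.coe_lt_coe] at hc ⊢
    exact hΨ.lsc s c hc

lemma lowerSemicontinuous_exitCost {Ξ : Set (EuclideanSpace ℝ (Fin d))} (hΞ : IsClosed Ξ) :
    LowerSemicontinuous fun γ : Curve Ω => extendTop Ψ (exitTime Ξ γ) := by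
  rw [lowerSemicontinuous_iff_isClosed_preimage]
  intro c
  -- the sublevel set of a monotone lower semicontinuous function is a closed initial segment
  have hcl : IsClosed (extendTop Ψ ⁻¹' Iic c) :=
    hΨ.lowerSemicontinuous_extendTop.isClosed_preimage c
  rcases (extendTop Ψ ⁻¹' Iic c).eq_empty_or_nonempty with he | hne
  · have : (fun γ : Curve Ω => extendTop Ψ (exitTime Ξ γ)) ⁻¹' Iic c = ∅ := by
      rw [eq_empty_iff_forall_notMem] at he ⊢
      exact fun γ hγ => he _ hγ
    rw [this]
    exact isClosed_empty
  · have hmem := hcl.sSup_mem hne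
    have : (fun γ : Curve Ω => extendTop Ψ (exitTime Ξ γ)) ⁻¹' Iic c =
        exitTime Ξ ⁻¹' Iic (sSup (extendTop Ψ ⁻¹' Iic c)) := by
      ext γ
      constructor
      · intro h
        exact le_sSup (show exitTime Ξ γ ∈ extendTop Ψ ⁻¹' Iic c from h)
      · intro h
        exact (hΨ.monotone_extendTop h).trans hmem
    rw [this]
    exact (lowerSemicontinuous_exitTime hΞ).isClosed_preimage _

end IsExitCost

end exit

/-! ### Lower semicontinuity of the cost of a pair of curves -/

section pair

variable {d : ℕ} {Ω : Set (EuclideanSpace ℝ (Fin d))}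

/-- Regularity assumptions on the interaction cost `h`. -/
structure IsInteraction
    (h : ℝ≥0 → closure Ω → closure Ω → EuclideanSpace ℝ (Fin d) →
      EuclideanSpace ℝ (Fin d) → ℝ≥0) : Prop where
  aemeasurable : ∀ x x' p p', AEMeasurable (fun t => h t x x' p p') lebesgueHalfLine
  continuous : ∀ᵐ t ∂lebesgueHalfLine,
    Continuous (fun z : (closure Ω × closure Ω) ×
        (EuclideanSpace ℝ (Fin d) × EuclideanSpace ℝ (Fin d)) => h t z.1.1 z.1.2 z.2.1 z.2.2)
  convex : ∀ᵐ t ∂lebesgueHalfLine, ∀ x x', ConvexOn ℝ univ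
    (fun q : EuclideanSpace ℝ (Fin d) × EuclideanSpace ℝ (Fin d) => (h t x x' q.1 q.2 : ℝ))

open Classical in
/-- The individual cost, set to `∞` on curves which are not absolutely continuous (for these the
almost everywhere derivative carries no information). -/
noncomputable def acCost (Ξ : Set (EuclideanSpace ℝ (Fin d)))
    (ℓ : ℝ≥0 → closure Ω → EuclideanSpace ℝ (Fin d) → ℝ≥0) (Ψ : ℝ≥0 → ℝ≥0) (γ : Curve Ω) :
    ℝ≥0∞ :=
  if IsAbsCont γ then individualCost Ξ ℓ Ψ γ else ⊤

/-- The total cost of a pair of curves: both individual costs and the interaction cost. -/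
noncomputable def totalPairCost (Ξ : Set (EuclideanSpace ℝ (Fin d)))
    (ℓ : ℝ≥0 → closure Ω → EuclideanSpace ℝ (Fin d) → ℝ≥0)
    (h : ℝ≥0 → closure Ω → closure Ω → EuclideanSpace ℝ (Fin d) →
      EuclideanSpace ℝ (Fin d) → ℝ≥0)
    (Ψ : ℝ≥0 → ℝ≥0) (z : Curve Ω × Curve Ω) : ℝ≥0∞ :=
  acCost Ξ ℓ Ψ z.1 + acCost Ξ ℓ Ψ z.2 + pairCost Ξ h z.1 z.2

open Classical in
/-- The running cost of a pair of curves which interact only during the times in `S`, as a function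
of the pair of positions and of the pair of velocities. -/
noncomputable def pairIntegrand
    (ℓ : ℝ≥0 → closure Ω → EuclideanSpace ℝ (Fin d) → ℝ≥0)
    (h : ℝ≥0 → closure Ω → closure Ω → EuclideanSpace ℝ (Fin d) →
      EuclideanSpace ℝ (Fin d) → ℝ≥0) (S : Set ℝ≥0) (t : ℝ≥0) (z : closure Ω × closure Ω)
    (q : EuclideanSpace ℝ (Fin d) × EuclideanSpace ℝ (Fin d)) : ℝ≥0 :=
  ℓ t z.1 q.1 + ℓ t z.2 q.2 + if t ∈ S then h t z.1 z.2 q.1 q.2 else 0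

variable {Ξ : Set (EuclideanSpace ℝ (Fin d))}
  {ℓ : ℝ≥0 → closure Ω → EuclideanSpace ℝ (Fin d) → ℝ≥0}
  {h : ℝ≥0 → closure Ω → closure Ω → EuclideanSpace ℝ (Fin d) →
      EuclideanSpace ℝ (Fin d) → ℝ≥0} {α θ : ℝ} {Ψ : ℝ≥0 → ℝ≥0} {a b : ℝ}

lemma isConvexIntegrand_pairIntegrand (hℓ : IsConvexIntegrand lebesgueHalfLine ℓ α θ)
    (hh : IsInteraction h) {S : Set ℝ≥0} (hS : MeasurableSet S) :
    IsConvexIntegrand lebesgueHalfLine (pairIntegrand ℓ h S) α θ where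
  aemeasurable z q := by
    classical
    refine ((hℓ.aemeasurable _ _).add (hℓ.aemeasurable _ _)).add ?_
    have := (hh.aemeasurable z.1 z.2 q.1 q.2).indicator hS
    refine this.congr (Eventually.of_forall fun t => ?_)
    by_cases ht : t ∈ S <;> simp [ht]
  continuous := by
    filter_upwards [hℓ.continuous, hh.continuous] with t h1 h2
    have h3 : Continuous fun w : (closure Ω × closure Ω) ×
        (EuclideanSpace ℝ (Fin d) × EuclideanSpace ℝ (Fin d)) => ℓ t w.1.1 w.2.1 :=
      h1.comp (f := fun w : (closure Ω × closure Ω) ×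
        (EuclideanSpace ℝ (Fin d) × EuclideanSpace ℝ (Fin d)) => (w.1.1, w.2.1)) (by fun_prop)
    have h4 : Continuous fun w : (closure Ω × closure Ω) ×
        (EuclideanSpace ℝ (Fin d) × EuclideanSpace ℝ (Fin d)) => ℓ t w.1.2 w.2.2 :=
      h1.comp (f := fun w : (closure Ω × closure Ω) ×
        (EuclideanSpace ℝ (Fin d) × EuclideanSpace ℝ (Fin d)) => (w.1.2, w.2.2)) (by fun_prop)
    unfold pairIntegrand
    by_cases ht : t ∈ S
    · simp only [ht, if_true]
      exact (h3.add h4).add h2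
    · simp only [ht, if_false, add_zero]
      exact h3.add h4
  convex := by
    filter_upwards [hℓ.convex, hh.convex] with t h1 h2 z
    have h3 := (h1 z.1).comp_linearMap (LinearMap.fst ℝ (EuclideanSpace ℝ (Fin d))
      (EuclideanSpace ℝ (Fin d)))
    have h4 := (h1 z.2).comp_linearMap (LinearMap.snd ℝ (EuclideanSpace ℝ (Fin d))
      (EuclideanSpace ℝ (Fin d)))
    rw [preimage_univ] at h3 h4
    unfold pairIntegrand
    by_cases ht : t ∈ S
    · simp only [ht, if_true, NNReal.coe_add]
      exact (h3.add h4).add (h2 z.1 z.2)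
    · simp only [ht, if_false, add_zero, NNReal.coe_add]
      exact h3.add h4
  pos := hℓ.pos
  one_lt := hℓ.one_lt
  lower t z q := by
    classical
    have h1 := hℓ.lower t z.1 q.1
    have h2 := hℓ.lower t z.2 q.2
    have h0 : (0 : ℝ) ≤ ((if t ∈ S then h t z.1 z.2 q.1 q.2 else 0 : ℝ≥0) : ℝ) :=
      NNReal.coe_nonneg _
    unfold pairIntegrand
    rw [NNReal.coe_add, NNReal.coe_add, Prod.norm_def]
    have h3 := (ℓ t z.1 q.1).coe_nonneg
    have h4 := (ℓ t z.2 q.2).coe_nonneg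
    rcases max_cases ‖q.1‖ ‖q.2‖ with ⟨h5, -⟩ | ⟨h5, -⟩ <;> rw [h5] <;> linarith

lemma IsConvexIntegrand.restrict {T X V : Type*} [MeasurableSpace T] [TopologicalSpace X]
    [NormedAddCommGroup V] [NormedSpace ℝ V] {μ : Measure T} {f : T → X → V → ℝ≥0} {α θ : ℝ}
    (hf : IsConvexIntegrand μ f α θ) (S : Set T) : IsConvexIntegrand (μ.restrict S) f α θ where
  aemeasurable x p := (hf.aemeasurable x p).restrict
  continuous := ae_restrict_of_ae hf.continuous
  convex := ae_restrict_of_ae hf.convex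
  pos := hf.pos
  one_lt := hf.one_lt
  lower := hf.lower

lemma lintegral_pairIntegrand (hℓ : IsConvexIntegrand lebesgueHalfLine ℓ α θ)
    {S : Set ℝ≥0} (hS : MeasurableSet S) (γ γ' : Curve Ω) :
    ∫⁻ t, (pairIntegrand ℓ h S t (γ t, γ' t) (velocity γ t, velocity γ' t) : ℝ≥0∞)
      ∂lebesgueHalfLine =
    ∫⁻ t, (ℓ t (γ t) (velocity γ t) : ℝ≥0∞) ∂lebesgueHalfLine +
      ∫⁻ t, (ℓ t (γ' t) (velocity γ' t) : ℝ≥0∞) ∂lebesgueHalfLine +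
      ∫⁻ t in S, (h t (γ t) (γ' t) (velocity γ t) (velocity γ' t) : ℝ≥0∞)
        ∂lebesgueHalfLine := by
  classical
  have hm : ∀ γ : Curve Ω, AEMeasurable (fun t => (ℓ t (γ t) (velocity γ t) : ℝ≥0∞))
      lebesgueHalfLine := fun γ =>
    (hℓ.aemeasurable_comp γ.continuous.measurable (measurable_velocity γ)).coe_nnreal_ennreal
  have hmm : AEMeasurable (fun t => (ℓ t (γ t) (velocity γ t) : ℝ≥0∞) +
      (ℓ t (γ' t) (velocity γ' t) : ℝ≥0∞)) lebesgueHalfLine := (hm γ).add (hm γ')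
  rw [← lintegral_indicator hS, ← lintegral_add_left' (hm γ), ← lintegral_add_left' hmm]
  refine lintegral_congr fun t => ?_
  unfold pairIntegrand
  by_cases ht : t ∈ S <;> simp [ht]

lemma measurableSet_lt_coe (σ : ℝ≥0∞) : MeasurableSet {t : ℝ≥0 | (t : ℝ≥0∞) < σ} :=
  measurableSet_lt measurable_coe_nnreal_ennreal measurable_const

/-- The running cost dominates `α ‖γ̇‖ ^ θ`. -/
lemma energy_le_individualCost (hℓ : IsConvexIntegrand lebesgueHalfLine ℓ α θ) (γ : Curve Ω) :
    energy θ γ ≤ (1 / α).toNNReal * individualCost Ξ ℓ Ψ γ := by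
  calc energy θ γ ≤ ∫⁻ t, (1 / α).toNNReal * (ℓ t (γ t) (velocity γ t) : ℝ≥0∞)
        ∂lebesgueHalfLine := by
        refine lintegral_mono fun t => ?_
        have hθ : 0 ≤ θ := by linarith [hℓ.one_lt]
        show ‖velocity γ t‖ₑ ^ θ ≤ ((1 / α).toNNReal : ℝ≥0∞) * (ℓ t (γ t) (velocity γ t) : ℝ≥0∞)
        rw [← ofReal_norm, ENNReal.ofReal_rpow_of_nonneg (norm_nonneg _) hθ,
          ← ENNReal.coe_mul, ← ENNReal.ofReal_coe_nnreal]
        refine ENNReal.ofReal_le_ofReal ?_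
        push_cast
        rw [Real.coe_toNNReal _ (one_div_pos.2 hℓ.pos).le, one_div, ← div_eq_inv_mul,
          le_div_iff₀ hℓ.pos, mul_comm]
        exact hℓ.lower _ _ _
    _ = (1 / α).toNNReal * ∫⁻ t, (ℓ t (γ t) (velocity γ t) : ℝ≥0∞) ∂lebesgueHalfLine :=
        lintegral_const_mul' _ _ ENNReal.coe_ne_top
    _ ≤ _ := by
        unfold individualCost
        gcongr
        exact le_self_add

lemma isAbsCont_of_acCost_ne_top {γ : Curve Ω} (hγ : acCost Ξ ℓ Ψ γ ≠ ⊤) : IsAbsCont γ := by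
  by_contra hn
  exact hγ (if_neg hn)

lemma acCost_of_isAbsCont {γ : Curve Ω} (hγ : IsAbsCont γ) :
    acCost Ξ ℓ Ψ γ = individualCost Ξ ℓ Ψ γ := if_pos hγ

lemma individualCost_le_acCost (γ : Curve Ω) : individualCost Ξ ℓ Ψ γ ≤ acCost Ξ ℓ Ψ γ := by
  by_cases hγ : IsAbsCont γ
  · rw [acCost_of_isAbsCont hγ]
  · simp [acCost, hγ]

lemma energy_le_of_acCost_le (hℓ : IsConvexIntegrand lebesgueHalfLine ℓ α θ) {γ : Curve Ω}
    {R : ℝ≥0} (hγ : acCost Ξ ℓ Ψ γ ≤ R) :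
    energy θ γ ≤ ((1 / α).toNNReal * R : ℝ≥0) := by
  refine (energy_le_individualCost (Ξ := Ξ) (Ψ := Ψ) hℓ γ).trans ?_
  rw [ENNReal.coe_mul]
  gcongr
  exact (individualCost_le_acCost γ).trans hγ

/-- The total cost of a pair of curves is jointly lower semicontinuous. The interaction is
integrated up to the first exit time, which is itself only lower semicontinuous: one therefore
applies the lower semicontinuity theorem with the interaction switched on during
`{t | t < σ, ∀ n ≥ k, t < σₙ}` and lets `k` tend to infinity. -/
theorem lowerSemicontinuous_totalPairCost (hΞ : IsClosed Ξ)
    (hℓ : IsConvexIntegrand lebesgueHalfLine ℓ α θ) (hh : IsInteraction h)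
    (hΨ : IsExitCost Ψ a b) :
    LowerSemicontinuous (totalPairCost Ξ ℓ h Ψ) := by
  refine lowerSemicontinuous_of_seq fun u z c hu hc => ?_
  by_cases hctop : c = ⊤
  · simp [hctop]
  lift c to ℝ≥0 using hctop
  have hc1 : ∀ n, acCost Ξ ℓ Ψ (u n).1 ≤ c := fun n =>
    (le_self_add.trans le_self_add).trans (hc n)
  have hc2 : ∀ n, acCost Ξ ℓ Ψ (u n).2 ≤ c := fun n =>
    (le_add_self.trans le_self_add).trans (hc n)
  have hac1 : ∀ n, IsAbsCont (u n).1 := fun n =>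
    isAbsCont_of_acCost_ne_top (ne_top_of_le_ne_top ENNReal.coe_ne_top (hc1 n))
  have hac2 : ∀ n, IsAbsCont (u n).2 := fun n =>
    isAbsCont_of_acCost_ne_top (ne_top_of_le_ne_top ENNReal.coe_ne_top (hc2 n))
  have he1 := fun n => energy_le_of_acCost_le hℓ (hc1 n)
  have he2 := fun n => energy_le_of_acCost_le hℓ (hc2 n)
  have hu1 : Tendsto (fun n => (u n).1) atTop (𝓝 z.1) := (continuous_fst.tendsto z).comp hu
  have hu2 : Tendsto (fun n => (u n).2) atTop (𝓝 z.2) := (continuous_snd.tendsto z).comp hu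
  have hlim1 : ∀ t, Tendsto (fun n => (u n).1 t) atTop (𝓝 (z.1 t)) := fun t =>
    ((continuous_eval_const t).tendsto _).comp hu1
  have hlim2 : ∀ t, Tendsto (fun n => (u n).2 t) atTop (𝓝 (z.2 t)) := fun t =>
    ((continuous_eval_const t).tendsto _).comp hu2
  have hz1 := isAbsCont_of_tendsto hℓ.one_lt hac1 he1 hlim1
  have hz2 := isAbsCont_of_tendsto hℓ.one_lt hac2 he2 hlim2
  let σ : Curve Ω × Curve Ω → ℝ≥0∞ := fun w => min (exitTime Ξ w.1) (exitTime Ξ w.2)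
  let S : ℕ → Set ℝ≥0 := fun k => {t | (t : ℝ≥0∞) < σ z} ∩ ⋂ n ≥ k, {t | (t : ℝ≥0∞) < σ (u n)}
  have hSm : ∀ k, MeasurableSet (S k) := fun k =>
    (measurableSet_lt_coe _).inter
      (MeasurableSet.iInter fun n => MeasurableSet.iInter fun _ => measurableSet_lt_coe _)
  have hSev : ∀ t : ℝ≥0, (t : ℝ≥0∞) < σ z → ∀ᶠ k in atTop, t ∈ S k := by
    intro t ht
    have h1 := hu1.eventually
      (lowerSemicontinuous_exitTime hΞ z.1 _ (ht.trans_le (min_le_left _ _)))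
    have h2 := hu2.eventually
      (lowerSemicontinuous_exitTime hΞ z.2 _ (ht.trans_le (min_le_right _ _)))
    obtain ⟨N, hN⟩ := eventually_atTop.1 (h1.and h2)
    filter_upwards [eventually_ge_atTop N] with k hk
    refine ⟨ht, mem_iInter₂.2 fun n hn => ?_⟩
    exact lt_min (hN n (hk.trans hn)).1 (hN n (hk.trans hn)).2
  let I : Set ℝ≥0 → Curve Ω × Curve Ω → ℝ≥0 → ℝ≥0∞ := fun S w t =>
    (pairIntegrand ℓ h S t (w.1 t, w.2 t) (velocity w.1 t, velocity w.2 t) : ℝ≥0∞)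
  have hIm : ∀ S, MeasurableSet S → ∀ w, AEMeasurable (I S w) lebesgueHalfLine := fun S hS w =>
    ((isConvexIntegrand_pairIntegrand hℓ hh hS).aemeasurable_comp
      (x := fun t => (w.1 t, w.2 t)) (v := fun t => (velocity w.1 t, velocity w.2 t))
      (w.1.continuous.measurable.prodMk w.2.continuous.measurable)
      ((measurable_velocity _).prodMk (measurable_velocity _))).coe_nnreal_ennreal
  let P : Curve Ω × Curve Ω → ℝ≥0∞ := fun w =>
    extendTop Ψ (exitTime Ξ w.1) + extendTop Ψ (exitTime Ξ w.2)
  have htotal : ∀ w : Curve Ω × Curve Ω, IsAbsCont w.1 → IsAbsCont w.2 →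
      totalPairCost Ξ ℓ h Ψ w =
        ∫⁻ t, I {t | (t : ℝ≥0∞) < σ w} w t ∂lebesgueHalfLine + P w := by
    intro w hw1 hw2
    have := lintegral_pairIntegrand (h := h) hℓ (measurableSet_lt_coe (σ w)) w.1 w.2
    simp only [I, this]
    unfold totalPairCost
    rw [acCost_of_isAbsCont hw1, acCost_of_isAbsCont hw2]
    unfold individualCost pairCost
    simp only [P, σ]
    ring
  have hP : P z ≤ liminf (fun n => P (u n)) atTop := by
    have hl := hΨ.lowerSemicontinuous_exitCost (Ω := Ω) hΞ
    have h1 := (lowerSemicontinuous_iff_le_liminf.1 hl z.1).trans (liminf_le_liminf_of_le hu1)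
    have h2 := (lowerSemicontinuous_iff_le_liminf.1 hl z.2).trans (liminf_le_liminf_of_le hu2)
    exact (add_le_add h1 h2).trans (add_liminf_le _ _)
  have hk : ∀ k : ℕ, ∫⁻ t in Iic (k : ℝ≥0), I (S k) z t ∂lebesgueHalfLine + P z ≤ c := by
    intro k
    have hv := (velocityTendsto_of_tendsto hℓ.one_lt hac1 he1 hlim1 k).prodMk hℓ.one_lt
      (velocityTendsto_of_tendsto hℓ.one_lt hac2 he2 hlim2 k)
    have h1 := lintegral_le_liminf_of_convex
      ((isConvexIntegrand_pairIntegrand hℓ hh (hSm k)).restrict (Iic (k : ℝ≥0)))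
      (xn := fun n t => ((u n).1 t, (u n).2 t)) (x := fun t => (z.1 t, z.2 t))
      (fun n => (u n).1.continuous.measurable.prodMk (u n).2.continuous.measurable)
      (z.1.continuous.measurable.prodMk z.2.continuous.measurable)
      (fun t => (hlim1 t).prodMk_nhds (hlim2 t)) hv
    refine (add_le_add h1 hP).trans ((add_liminf_le _ _).trans ?_)
    calc _ ≤ liminf (fun _ : ℕ => (c : ℝ≥0∞)) atTop := by
          refine liminf_le_liminf ?_
          filter_upwards [eventually_ge_atTop k] with n hn
          refine le_trans ?_ (hc n)
          rw [htotal _ (hac1 n) (hac2 n)]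
          refine add_le_add ((setLIntegral_le_lintegral _ _).trans ?_) le_rfl
          simp only [I]
          rw [lintegral_pairIntegrand hℓ (hSm k),
            lintegral_pairIntegrand hℓ (measurableSet_lt_coe _)]
          gcongr
          intro t ht
          exact mem_iInter₂.1 ht.2 n hn
      _ = c := by simp
  rw [htotal z hz1 hz2]
  calc ∫⁻ t, I {t | (t : ℝ≥0∞) < σ z} z t ∂lebesgueHalfLine + P z
      ≤ ∫⁻ t, liminf (fun k : ℕ => (Iic (k : ℝ≥0)).indicator (I (S k) z) t) atTop
          ∂lebesgueHalfLine + P z := by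
        gcongr with t
        have hev : ∀ᶠ k : ℕ in atTop, (Iic (k : ℝ≥0)).indicator (I (S k) z) t =
            I {t | (t : ℝ≥0∞) < σ z} z t := by
          obtain ⟨N, hN⟩ := exists_nat_ge t
          have hS : ∀ᶠ k in atTop, (t ∈ S k ↔ t ∈ {t : ℝ≥0 | (t : ℝ≥0∞) < σ z}) := by
            by_cases ht : (t : ℝ≥0∞) < σ z
            · filter_upwards [hSev t ht] with k hk
              exact ⟨fun _ => ht, fun _ => hk⟩
            · exact Eventually.of_forall fun k => ⟨fun hk => absurd hk.1 ht, fun h => absurd h ht⟩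
          filter_upwards [eventually_ge_atTop N, hS] with k hk hkS
          rw [indicator_of_mem (show t ∈ Iic (k : ℝ≥0) from hN.trans (by exact_mod_cast hk))]
          by_cases ht : t ∈ {t : ℝ≥0 | (t : ℝ≥0∞) < σ z}
          · simp only [I, pairIntegrand, if_pos ht, if_pos (hkS.2 ht)]
          · simp only [I, pairIntegrand, if_neg ht, if_neg (mt hkS.1 ht)]
        rw [liminf_congr hev]
        simp
    _ ≤ liminf (fun k : ℕ => ∫⁻ t, (Iic (k : ℝ≥0)).indicator (I (S k) z) t
          ∂lebesgueHalfLine) atTop + P z := by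
        gcongr
        exact lintegral_liminf_le' fun k => (hIm _ (hSm k) z).indicator measurableSet_Iic
    _ = liminf (fun k : ℕ => ∫⁻ t in Iic (k : ℝ≥0), I (S k) z t ∂lebesgueHalfLine) atTop +
          liminf (fun _ : ℕ => P z) atTop := by
        simp only [lintegral_indicator measurableSet_Iic, liminf_const]
    _ ≤ liminf (fun k : ℕ => ∫⁻ t in Iic (k : ℝ≥0), I (S k) z t ∂lebesgueHalfLine + P z) atTop :=
        add_liminf_le _ _
    _ ≤ liminf (fun _ : ℕ => (c : ℝ≥0∞)) atTop :=
        liminf_le_liminf (Eventually.of_forall hk)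
    _ = c := by simp

/-- The case of two copies of the same curve without interaction: the pair then costs twice the
individual cost. -/
lemma lowerSemicontinuous_acCost (hΞ : IsClosed Ξ)
    (hℓ : IsConvexIntegrand lebesgueHalfLine ℓ α θ) (hΨ : IsExitCost Ψ a b) :
    LowerSemicontinuous (acCost Ξ ℓ Ψ) := by
  have h0 : IsInteraction (Ω := Ω) fun _ _ _ _ _ => 0 :=
    ⟨fun _ _ _ _ => aemeasurable_const, Eventually.of_forall fun _ => continuous_const,
      Eventually.of_forall fun _ _ _ => convexOn_const _ convex_univ⟩
  have h1 := (lowerSemicontinuous_totalPairCost hΞ hℓ h0 hΨ).comp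
    (show Continuous fun γ : Curve Ω => (γ, γ) by fun_prop)
  rw [lowerSemicontinuous_iff_isClosed_preimage] at h1 ⊢
  intro c
  convert! h1 (c + c) using 1
  ext γ
  simp only [mem_preimage, mem_Iic, Function.comp_apply, totalPairCost, pairCost,
    ENNReal.coe_zero, lintegral_zero, add_zero]
  constructor
  · exact fun hγ => add_le_add hγ hγ
  · intro hγ
    by_contra! hlt
    exact absurd (ENNReal.add_lt_add hlt hlt) (not_lt.2 hγ)

lemma isCompact_acCost_sublevel (hΩ : Bornology.IsBounded Ω) (hΞ : IsClosed Ξ)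
    (hℓ : IsConvexIntegrand lebesgueHalfLine ℓ α θ) (hΨ : IsExitCost Ψ a b) (R : ℝ≥0) :
    IsCompact {γ : Curve Ω | acCost Ξ ℓ Ψ γ ≤ R} := by
  have : CompactSpace (closure Ω) := isCompact_iff_compactSpace.1 hΩ.isCompact_closure
  refine (isCompact_setOf_modulus (T := ℝ≥0) (X := closure Ω)
    (tendsto_holderModulus hℓ.one_lt ((1 / α).toNNReal * R))).of_isClosed_subset
    ((lowerSemicontinuous_acCost hΞ hℓ hΨ).isClosed_preimage (R : ℝ≥0∞)) ?_
  intro γ hγ s t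
  have hγ' : acCost Ξ ℓ Ψ γ ≤ R := hγ
  exact edist_le_holderModulus hℓ.one_lt
    (isAbsCont_of_acCost_ne_top (ne_top_of_le_ne_top ENNReal.coe_ne_top hγ'))
    (energy_le_of_acCost_le hℓ hγ') s t

lemma pairCost_comm (hsymm : ∀ t x x' p p', h t x x' p p' = h t x' x p' p) (γ γ' : Curve Ω) :
    pairCost Ξ h γ γ' = pairCost Ξ h γ' γ := by
  unfold pairCost
  rw [min_comm]
  exact lintegral_congr fun t => by rw [hsymm]

/-- The interaction cost is dominated by the individual costs: the exit time controls the constant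
part of the growth of `h` and the running cost controls the rest. -/
lemma exists_pairCost_le (hℓ : IsConvexIntegrand lebesgueHalfLine ℓ α θ) (hΨ : IsExitCost Ψ a b)
    {C β : ℝ} (hC : 0 < C) (hβ : 0 < β) (hβθ : β ≤ θ)
    (hupper : ∀ t x x' p p', (h t x x' p p' : ℝ) ≤ C * (‖p‖ ^ β + ‖p'‖ ^ β)) :
    ∃ K₁ K₂ : ℝ≥0, ∀ γ γ' : Curve Ω,
      pairCost Ξ h γ γ' ≤ K₁ + K₂ * (individualCost Ξ ℓ Ψ γ + individualCost Ξ ℓ Ψ γ') := by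
  have hpow : ∀ p : EuclideanSpace ℝ (Fin d), ‖p‖ ^ β ≤ 1 + ‖p‖ ^ θ := by
    intro p
    by_cases hp : ‖p‖ ≤ 1
    · have := Real.rpow_le_one (norm_nonneg p) hp hβ.le
      have := Real.rpow_nonneg (norm_nonneg p) θ
      linarith
    · have := Real.rpow_le_rpow_of_exponent_le (not_le.1 hp).le hβθ
      linarith
  have hθ : 0 ≤ θ := by linarith [hℓ.one_lt]
  have hpt : ∀ t x x' p p', (h t x x' p p' : ℝ≥0∞) ≤
      C.toNNReal * (2 + (‖p‖ₑ ^ θ + ‖p'‖ₑ ^ θ)) := by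
    intro t x x' p p'
    have h1 : (h t x x' p p' : ℝ) ≤ C * (2 + (‖p‖ ^ θ + ‖p'‖ ^ θ)) := by
      refine (hupper t x x' p p').trans ?_
      exact mul_le_mul_of_nonneg_left (by linarith [hpow p, hpow p']) hC.le
    rw [← ENNReal.ofReal_coe_nnreal]
    refine (ENNReal.ofReal_le_ofReal h1).trans_eq ?_
    have n1 := Real.rpow_nonneg (norm_nonneg p) θ
    have n2 := Real.rpow_nonneg (norm_nonneg p') θ
    rw [ENNReal.ofReal_mul hC.le, ENNReal.ofReal_add (by norm_num) (by positivity),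
      ENNReal.ofReal_add n1 n2, ← ENNReal.ofReal_rpow_of_nonneg (norm_nonneg _) hθ,
      ← ENNReal.ofReal_rpow_of_nonneg (norm_nonneg _) hθ, ofReal_norm, ofReal_norm]
    simp [ENNReal.ofReal]
  set c := C.toNNReal
  set A := (1 / a).toNNReal
  set B := b.toNNReal
  set D := (1 / α).toNNReal
  refine ⟨c * (2 * (A * B)), c * (2 * A + D), fun γ γ' => ?_⟩
  set J := individualCost Ξ ℓ Ψ γ with hJ
  set J' := individualCost Ξ ℓ Ψ γ' with hJ'
  have hexit : exitTime Ξ γ ≤ A * (J + B) := by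
    refine (hΨ.le_extendTop _).trans ?_
    gcongr
    exact le_add_self
  set U := {t : ℝ≥0 | (t : ℝ≥0∞) < min (exitTime Ξ γ) (exitTime Ξ γ')} with hU
  have hUle : lebesgueHalfLine U ≤ A * (J + B) :=
    (lebesgueHalfLine_lt_le _).trans ((min_le_left _ _).trans hexit)
  calc pairCost Ξ h γ γ'
      ≤ ∫⁻ t in U, c * (2 + (‖velocity γ t‖ₑ ^ θ + ‖velocity γ' t‖ₑ ^ θ)) ∂lebesgueHalfLine :=
        lintegral_mono fun t => hpt _ _ _ _ _
    _ = c * (2 * lebesgueHalfLine U + (∫⁻ t in U, ‖velocity γ t‖ₑ ^ θ ∂lebesgueHalfLine +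
          ∫⁻ t in U, ‖velocity γ' t‖ₑ ^ θ ∂lebesgueHalfLine)) := by
        rw [lintegral_const_mul' _ _ ENNReal.coe_ne_top, lintegral_add_left measurable_const,
          setLIntegral_const, lintegral_add_left ((measurable_velocity γ).enorm.pow_const θ)]
    _ ≤ c * (2 * (A * (J + B)) + (D * J + D * J')) := by
        gcongr
        · exact (setLIntegral_le_lintegral _ _).trans (energy_le_individualCost hℓ γ)
        · exact (setLIntegral_le_lintegral _ _).trans (energy_le_individualCost hℓ γ')
    _ ≤ c * (2 * (A * (J + B)) + (D * J + D * J')) + c * (2 * A * J') := le_self_add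
    _ = _ := by
        push_cast
        ring

end pair

/-! ### The marginal of the pair cost -/

section equilibrium

variable {d : ℕ} {Ω Ξ : Set (EuclideanSpace ℝ (Fin d))}
  {ℓ : ℝ≥0 → closure Ω → EuclideanSpace ℝ (Fin d) → ℝ≥0}
  {h : ℝ≥0 → closure Ω → closure Ω → EuclideanSpace ℝ (Fin d) →
      EuclideanSpace ℝ (Fin d) → ℝ≥0} {Ψ : ℝ≥0 → ℝ≥0}

/-- Against a population of finite mean individual cost, the cost `F(·, Q)` is the marginal of the
total pair cost up to an additive constant. In particular it is measurable. -/
lemma cost_add_lintegral_acCost {K₁ K₂ : ℝ≥0}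
    (hL : LowerSemicontinuous (acCost Ξ ℓ Ψ)) (hG : LowerSemicontinuous (totalPairCost Ξ ℓ h Ψ))
    (hK : ∀ γ γ' : Curve Ω,
      pairCost Ξ h γ γ' ≤ K₁ + K₂ * (individualCost Ξ ℓ Ψ γ + individualCost Ξ ℓ Ψ γ'))
    {Q : ProbabilityMeasure (Curve Ω)}
    (hQ : ∫⁻ γ, acCost Ξ ℓ Ψ γ ∂(Q : Measure (Curve Ω)) ≠ ⊤) (γ : Curve Ω) :
    cost Ξ ℓ h Ψ γ Q + ∫⁻ γ', acCost Ξ ℓ Ψ γ' ∂(Q : Measure (Curve Ω)) =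
      ∫⁻ γ', totalPairCost Ξ ℓ h Ψ (γ, γ') ∂(Q : Measure (Curve Ω)) := by
  have hLm := hL.measurable
  by_cases hγ : acCost Ξ ℓ Ψ γ = ⊤
  · have h1 : cost Ξ ℓ h Ψ γ Q = ⊤ := by
      unfold cost
      split_ifs with hc
      · rw [acCost_of_isAbsCont hc.1] at hγ
        simp [hγ]
      · rfl
    simp [totalPairCost, hγ, h1]
  have hac := isAbsCont_of_acCost_ne_top hγ
  have hfin : ∀ᵐ γ' ∂(Q : Measure (Curve Ω)), acCost Ξ ℓ Ψ γ' < ⊤ := ae_lt_top hLm hQ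
  have hacQ : ∀ᵐ γ' ∂(Q : Measure (Curve Ω)), IsAbsCont γ' :=
    hfin.mono fun γ' h' => isAbsCont_of_acCost_ne_top h'.ne
  -- the interaction cost is recovered as a difference of measurable functions
  have hpm : AEMeasurable (fun γ' => pairCost Ξ h γ γ') (Q : Measure (Curve Ω)) := by
    have hd : Measurable fun γ' => totalPairCost Ξ ℓ h Ψ (γ, γ') -
        (acCost Ξ ℓ Ψ γ + acCost Ξ ℓ Ψ γ') :=
      (hG.measurable.comp measurable_prodMk_left).sub (hLm.const_add _)
    refine ⟨_, hd, hfin.mono fun γ' h' => ?_⟩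
    exact (ENNReal.add_sub_cancel_left (ENNReal.add_ne_top.2 ⟨hγ, h'.ne⟩)).symm
  have hpfin : ∫⁻ γ', pairCost Ξ h γ γ' ∂(Q : Measure (Curve Ω)) < ⊤ := by
    calc ∫⁻ γ', pairCost Ξ h γ γ' ∂(Q : Measure (Curve Ω))
        ≤ ∫⁻ γ', (K₁ + K₂ * (acCost Ξ ℓ Ψ γ + acCost Ξ ℓ Ψ γ')) ∂(Q : Measure (Curve Ω)) := by
          refine lintegral_mono fun γ' => (hK γ γ').trans ?_
          gcongr <;> exact individualCost_le_acCost _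
      _ = K₁ + K₂ * (acCost Ξ ℓ Ψ γ + ∫⁻ γ', acCost Ξ ℓ Ψ γ' ∂(Q : Measure (Curve Ω))) := by
          rw [lintegral_add_left measurable_const, lintegral_const_mul _ (hLm.const_add _),
            lintegral_add_left measurable_const]
          simp
      _ < ⊤ := by finiteness
  unfold cost
  rw [if_pos ⟨hac, hacQ, hpm, hpfin⟩]
  simp only [totalPairCost]
  rw [lintegral_add_left (hLm.const_add _), lintegral_add_left measurable_const,
    lintegral_const, measure_univ, mul_one, acCost_of_isAbsCont hac]
  ring

end equilibrium

end MFG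

theorem mainTheorem6 {d : ℕ} (hd : 0 < d)
    (Ω : Set (EuclideanSpace ℝ (Fin d)))
    (hΩ_nonempty : Ω.Nonempty) (hΩ_open : IsOpen Ω) (hΩ_bounded : Bornology.IsBounded Ω)
    (Ξ : Set (EuclideanSpace ℝ (Fin d)))
    (hΞ_sub : Ξ ⊆ closure Ω) (hΞ_nonempty : Ξ.Nonempty) (hΞ_closed : IsClosed Ξ)
    (ℓ : ℝ≥0 → closure Ω → EuclideanSpace ℝ (Fin d) → ℝ≥0)
    (hℓ_meas : ∀ x p, AEMeasurable (fun t => ℓ t x p) MFG.lebesgueHalfLine)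
    (hℓ_cont : ∀ᵐ t ∂MFG.lebesgueHalfLine,
      Continuous (fun z : closure Ω × EuclideanSpace ℝ (Fin d) => ℓ t z.1 z.2))
    (hℓ_convex : ∀ᵐ t ∂MFG.lebesgueHalfLine, ∀ x,
      ConvexOn ℝ Set.univ (fun p => (ℓ t x p : ℝ)))
    (α θ : ℝ) (hα : 0 < α) (hθ : 1 < θ)
    (hℓ_lower : ∀ t x p, α * ‖p‖ ^ θ ≤ (ℓ t x p : ℝ))
    (h : ℝ≥0 → closure Ω → closure Ω → EuclideanSpace ℝ (Fin d) →
      EuclideanSpace ℝ (Fin d) → ℝ≥0)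
    (hh_meas : ∀ x x' p p', AEMeasurable (fun t => h t x x' p p') MFG.lebesgueHalfLine)
    (hh_cont : ∀ᵐ t ∂MFG.lebesgueHalfLine,
      Continuous (fun z : (closure Ω × closure Ω) ×
          (EuclideanSpace ℝ (Fin d) × EuclideanSpace ℝ (Fin d)) =>
        h t z.1.1 z.1.2 z.2.1 z.2.2))
    (hh_convex : ∀ᵐ t ∂MFG.lebesgueHalfLine, ∀ x x',
      ConvexOn ℝ Set.univ
        (fun q : EuclideanSpace ℝ (Fin d) × EuclideanSpace ℝ (Fin d) =>
          (h t x x' q.1 q.2 : ℝ)))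
    (hh_symm : ∀ t x x' p p', h t x x' p p' = h t x' x p' p)
    (C β : ℝ) (hC : 0 < C) (hβ_pos : 0 < β) (hβ_le : β ≤ θ)
    (hh_upper : ∀ t x x' p p', (h t x x' p p' : ℝ) ≤ C * (‖p‖ ^ β + ‖p'‖ ^ β))
    (Ψ : ℝ≥0 → ℝ≥0)
    (hΨ_lsc : LowerSemicontinuous Ψ) (hΨ_mono : Monotone Ψ)
    (a b : ℝ) (ha : 0 < a) (hb : 0 < b)
    (hΨ_lower : ∀ t : ℝ≥0, a * (t : ℝ) - b ≤ (Ψ t : ℝ))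
    (κ : ℝ≥0) (hκ : 0 < κ)
    (h_access : ∀ x₀ : closure Ω, ∃ γ : MFG.Curve Ω, MFG.IsAbsCont γ ∧ γ 0 = x₀ ∧
      MFG.individualCost Ξ ℓ Ψ γ ≤ (κ : ℝ≥0∞))
    (m₀ : MeasureTheory.ProbabilityMeasure (closure Ω)) :
    ∃ Q : MeasureTheory.ProbabilityMeasure (MFG.Curve Ω),
      MFG.IsEquilibrium Ξ ℓ h Ψ m₀ Q := by
  have hℓ : MFG.IsConvexIntegrand MFG.lebesgueHalfLine ℓ α θ :=
    ⟨hℓ_meas, hℓ_cont, hℓ_convex, hα, hθ, hℓ_lower⟩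
  have hh : MFG.IsInteraction h := ⟨hh_meas, hh_cont, hh_convex⟩
  have hΨ : MFG.IsExitCost Ψ a b := ⟨hΨ_lsc, hΨ_mono, ha, hb, hΨ_lower⟩
  obtain ⟨K₁, K₂, hK⟩ := MFG.exists_pairCost_le (Ξ := Ξ) hℓ hΨ hC hβ_pos hβ_le hh_upper
  have hL := MFG.lowerSemicontinuous_acCost (Ω := Ω) hΞ_closed hℓ hΨ
  have hG := MFG.lowerSemicontinuous_totalPairCost hΞ_closed hℓ hh hΨ
  have g : MFG.PairGame (fun γ : MFG.Curve Ω => γ 0) (MFG.acCost Ξ ℓ Ψ)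
      (MFG.totalPairCost Ξ ℓ h Ψ) K₁ (K₂ + 1) κ :=
    { continuous_start := continuous_eval_const 0
      isCompact_sublevel := MFG.isCompact_acCost_sublevel hΩ_bounded hΞ_closed hℓ hΨ
      lsc_pair := hG
      symm := fun γ γ' => by
        simp only [MFG.totalPairCost, MFG.pairCost_comm hh_symm γ γ']
        ring
      le_pair := fun γ γ' => le_self_add.trans le_self_add
      pair_le := fun γ γ' => by
        have h1 := hK γ γ'
        have h2 := MFG.individualCost_le_acCost (Ξ := Ξ) (ℓ := ℓ) (Ψ := Ψ) γ
        have h3 := MFG.individualCost_le_acCost (Ξ := Ξ) (ℓ := ℓ) (Ψ := Ψ) γ'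
        calc MFG.acCost Ξ ℓ Ψ γ + MFG.acCost Ξ ℓ Ψ γ' + MFG.pairCost Ξ h γ γ'
            ≤ MFG.acCost Ξ ℓ Ψ γ + MFG.acCost Ξ ℓ Ψ γ' +
              (K₁ + K₂ * (MFG.acCost Ξ ℓ Ψ γ + MFG.acCost Ξ ℓ Ψ γ')) := by
              refine add_le_add le_rfl (h1.trans ?_)
              gcongr
          _ = _ := by
              push_cast
              ring
      access := fun x => by
        obtain ⟨γ, hγ, hγx, hγκ⟩ := h_access x
        exact ⟨γ, hγx, (MFG.acCost_of_isAbsCont hγ).trans_le hγκ⟩ }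
  obtain ⟨Q, hQ, hfin, hmin⟩ := g.exists_minimizer m₀
  have hopt := g.ae_optimal hQ hfin hmin
  have hc : ∫⁻ γ, MFG.acCost Ξ ℓ Ψ γ ∂(Q : Measure (MFG.Curve Ω)) ≠ ⊤ :=
    ((g.lintegral_cost_le_pairEnergy Q).trans_lt hfin).ne
  have hcost := MFG.cost_add_lintegral_acCost hL hG hK hc
  refine ⟨Q, hQ, ?_, ?_, ?_⟩
  · have hm := (g.lsc_marginal Q).measurable.sub_const
      (∫⁻ γ, MFG.acCost Ξ ℓ Ψ γ ∂(Q : Measure (MFG.Curve Ω)))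
    refine hm.aemeasurable.congr (Filter.Eventually.of_forall fun γ => ?_)
    simp only [← hcost γ]
    exact ENNReal.add_sub_cancel_right hc
  · refine lt_of_le_of_lt (lintegral_mono fun γ => ?_) hfin
    exact le_self_add.trans (hcost γ).le
  · filter_upwards [hopt] with γ hγ
    refine le_antisymm (le_iInf fun ω => ?_) (iInf_le_of_le ⟨γ, rfl⟩ le_rfl)
    -- the marginal of `G` and the cost differ by a finite constant
    have h1 := hγ ω.1 ω.2
    rw [← hcost, ← hcost] at h1
    exact (ENNReal.add_le_add_iff_right hc).1 h1
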